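/- For positive integers $m,n$ let $$f_4(m,n)=\Big|\Big\{(a_1,a_2,a_3,a_4)\in\mathbb{Z}_{>0}^4:\ a_1\le a_2\le a_3\le a_4,\ \frac{m}{n}=\frac1{a_1}+\frac1{a_2}+\frac1{a_3}+\frac1{a_4}\Big\}\Big|$$ be the number of representations of $m/n$ as a sum of four unit fractions. Then for every $\varepsilon>0$ there is a constant $C_\varepsilon>0$, depending only on $\varepsilon$, such that for all positive integers $m,n$ the number $f_4(m,n)$ is finite and $$f_4(m,n)\le C_\varepsilon\, n^{\varepsilon}\min\bigg\{\frac{n^{3/2}}{m^{3/4}},\ \frac{n^{8/5}}{m},\ \frac{n^{4/3}}{m^{2/3}}+\frac{n^{28/17}}{m^{8/5}},\ \Big(\frac{n}{m}\Big)^{5/3}+\frac{n^{4/3}}{m^{2/3}}\bigg\}.$$ -/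

import Mathlib

/-- The representations of `m / n` as a sum of `k` unit fractions: the `k`-tuples
`a₁ ≤ ⋯ ≤ aₖ` of positive integers with `m / n = 1 / a₁ + ⋯ + 1 / aₖ` (in `ℚ`). -/
def unitFractionReps (k m n : ℕ) : Set (Fin k → ℕ) :=
  {a | (∀ i, 0 < a i) ∧ Monotone a ∧ (m : ℚ) / (n : ℚ) = ∑ i, 1 / (a i : ℚ)}

/-- The number of representations of `m / n` as a sum of `k` unit fractions. -/
noncomputable def numUnitFractionReps (k m n : ℕ) : ℕ :=
  (unitFractionReps k m n).ncard

/-! Up to factors `n ^ ε`, everything is done by listing divisors. Once a positive integer of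
polynomial size is known, each of its divisors is known up to `n ^ ε` choices (`FiberBound.of_dvd`).
So are two unknowns in `A x y = B x + C y + E` with known coefficients, because `(A x - C) (A y - B)
= B C + A E` (`factor_bilinear`). A representation is thus determined, up to `n ^ ε` choices, by any
single integer key that starts a chain of such deductions. If several keys all do this, and a
product of their powers with total exponent `k` is at most `M`, then one of the keys is always at
most `M ^ (1 / k)`, and this bounds the number of representations (`card_le_of_keys`).

The parameters come from writing `N / b i = d i / t i` in lowest terms and setting `L = lcm t i`, `y
i = L / t i`. Then `u / N = ∑ 1 / b i` becomes `u L = ∑ d i y i` with `d i ∣ N`, and no prime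
divides all but one of the `y i` (`exists_lcm_param`). For three terms the `y i` are therefore
pairwise coprime and `L = w y₁ y₂ y₃`. For four terms each `y i` is a product of pairwise gcds `h`
and a cofactor `s`.

Let `a` and `b` be the two smallest denominators, and let `j` be the index of `a` among the integers
exceeding `n / m`, counted from 0. Since `m j ≤ m a - n` and `m a ≤ 4 n`, one gets `j b ≤ 12 n² /
m²`.

If `j = 0`, then `a` is known and three unit fractions remain, with `N = n a = O(n² / m)`. The keys
`quot₃`, `quot₁`, `y₃ w`, `y₂ y₃` with exponents 1, 1, 2, 1 have product `O(N³)`, which gives `N ^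
(3/5)`, that is `n ^ (6/5) / m ^ (3/5)`.

If `j > 0`, the keys `j y₂ y₃`, `j y₂ w`, `j y₃ w` have product `O((n / m)⁵)`, which gives `(n / m)
^ (5/3)`. Alternatively, the four-term keys `keyA`, `j h₁₄ s₁`, `keyC` with exponents 1, 2, 1 have
product `O(n⁶ / m⁵)`, which gives `n ^ (3/2) / m ^ (5/4)`. The first bound plus the minimum of the
other two is dominated by each of the four claimed expressions, because `m ≤ 4 n` whenever a
representation exists (`add_min_le_min`). -/

/-! ### The divisor bound -/

/-- The divisor bound: a positive integer `n` has `O_ε(n ^ ε)` divisors. -/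
theorem exists_card_divisors_le_rpow {ε : ℝ} (hε : 0 < ε) :
    ∃ C : ℝ, 1 ≤ C ∧ ∀ n : ℕ, 0 < n → (n.divisors.card : ℝ) ≤ C * (n : ℝ) ^ ε := by
  -- This `c` makes `v + 1 ≤ c * (1 + v ε log 2) ≤ c * 2 ^ (ε v)`, so it serves every prime at once.
  set c : ℝ := 1 + 1 / (ε * Real.log 2) with hc
  have hl : 0 < ε * Real.log 2 := mul_pos hε (Real.log_pos (by norm_num))
  have hc1 : 1 ≤ c := by rw [hc]; linarith [one_div_pos.mpr hl]
  -- For `p ≥ P` one has `p ^ ε ≥ 2`, so `v + 1 ≤ 2 ^ v` suffices without a constant. Only the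
  -- primes below `P` contribute a factor `c`.
  obtain ⟨P, hP⟩ := exists_nat_ge ((2 : ℝ) ^ (1 / ε))
  refine ⟨c ^ P, one_le_pow₀ hc1, fun n hn => ?_⟩
  have key : ∀ p ∈ n.primeFactors, ((n.factorization p + 1 : ℕ) : ℝ) ≤
      (if p < P then c else 1) * ((p ^ n.factorization p : ℕ) : ℝ) ^ ε := by
    intro p hp
    have hp2 : (2 : ℝ) ≤ p := by exact_mod_cast (Nat.prime_of_mem_primeFactors hp).two_le
    set v := n.factorization p
    have hpow : ((p ^ v : ℕ) : ℝ) ^ ε = ((p : ℝ) ^ ε) ^ v := by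
      push_cast
      rw [← Real.rpow_natCast, ← Real.rpow_mul (by positivity), mul_comm,
        Real.rpow_mul (by positivity), Real.rpow_natCast]
    rw [hpow]
    split_ifs with h
    · have h1 : 1 + (v : ℝ) * (ε * Real.log 2) ≤ ((p : ℝ) ^ ε) ^ v := by
        calc 1 + (v : ℝ) * (ε * Real.log 2) ≤ Real.exp ((v : ℝ) * (ε * Real.log 2)) := by
              linarith [Real.add_one_le_exp ((v : ℝ) * (ε * Real.log 2))]
          _ = ((2 : ℝ) ^ ε) ^ v := by
              rw [Real.rpow_def_of_pos (by norm_num), ← Real.exp_nat_mul]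
              ring_nf
          _ ≤ ((p : ℝ) ^ ε) ^ v := by gcongr
      have h2 : ((v + 1 : ℕ) : ℝ) ≤ c * (1 + (v : ℝ) * (ε * Real.log 2)) := by
        have : c * (1 + (v : ℝ) * (ε * Real.log 2)) =
            1 + v + (v : ℝ) * (ε * Real.log 2) + 1 / (ε * Real.log 2) := by
          rw [hc]; field_simp; ring
        rw [this]; push_cast
        have := one_div_pos.mpr hl
        have : 0 ≤ (v : ℝ) * (ε * Real.log 2) := by positivity
        linarith
      exact h2.trans (by gcongr)
    · have h1 : (2 : ℝ) ≤ (p : ℝ) ^ ε := by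
        calc (2 : ℝ) = ((2 : ℝ) ^ (1 / ε)) ^ ε := by
              rw [← Real.rpow_mul (by norm_num), one_div_mul_cancel hε.ne', Real.rpow_one]
          _ ≤ (p : ℝ) ^ ε := by
              gcongr
              exact hP.trans (by exact_mod_cast not_lt.mp h)
      rw [one_mul]
      calc ((v + 1 : ℕ) : ℝ) ≤ ((2 ^ v : ℕ) : ℝ) := by exact_mod_cast Nat.lt_two_pow_self
        _ = (2 : ℝ) ^ v := by push_cast; rfl
        _ ≤ _ := by gcongr
  have hfac : ∏ p ∈ n.primeFactors, ((p ^ n.factorization p : ℕ) : ℝ) ^ ε = (n : ℝ) ^ ε := by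
    rw [Real.finsetProd_rpow _ _ (fun _ _ => by positivity), ← Nat.cast_prod]
    congr 2
    exact Nat.prod_factorization_pow_eq_self hn.ne'
  have hcst : ∏ p ∈ n.primeFactors, (if p < P then c else 1) ≤ c ^ P := by
    rw [Finset.prod_ite, Finset.prod_const, Finset.prod_const_one, mul_one]
    refine pow_le_pow_right₀ hc1 ?_
    calc _ ≤ (Finset.range P).card :=
          Finset.card_le_card fun p hp => by simpa using (Finset.mem_filter.mp hp).2
      _ = P := Finset.card_range P
  calc (n.divisors.card : ℝ) = ∏ p ∈ n.primeFactors, ((n.factorization p + 1 : ℕ) : ℝ) := by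
        rw [Nat.card_divisors hn.ne']; push_cast; rfl
    _ ≤ ∏ p ∈ n.primeFactors, ((if p < P then c else 1) *
          ((p ^ n.factorization p : ℕ) : ℝ) ^ ε) :=
        Finset.prod_le_prod (fun _ _ => by positivity) key
    _ ≤ c ^ P * (n : ℝ) ^ ε := by
        rw [Finset.prod_mul_distrib, hfac]; gcongr

/-- The largest number of divisors of a positive integer up to `X`. -/
def maxDivisors (X : ℕ) : ℕ := (Finset.Icc 1 X).sup fun k => k.divisors.card

theorem card_divisors_le_maxDivisors {X k : ℕ} (h0 : 0 < k) (hk : k ≤ X) :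
    k.divisors.card ≤ maxDivisors X :=
  Finset.le_sup (f := fun k : ℕ => k.divisors.card) (Finset.mem_Icc.mpr ⟨h0, hk⟩)

theorem one_le_maxDivisors {X : ℕ} (hX : 0 < X) : 1 ≤ maxDivisors X :=
  (by simp : 1 ≤ (Nat.divisors 1).card).trans (card_divisors_le_maxDivisors one_pos hX)

theorem exists_maxDivisors_le_rpow {ε : ℝ} (hε : 0 < ε) :
    ∃ C : ℝ, 1 ≤ C ∧ ∀ X : ℕ, 0 < X → (maxDivisors X : ℝ) ≤ C * (X : ℝ) ^ ε := by
  obtain ⟨C, hC, h⟩ := exists_card_divisors_le_rpow hε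
  refine ⟨C, hC, fun X hX => ?_⟩
  obtain ⟨k, hk, hk'⟩ := Finset.exists_mem_eq_sup (Finset.Icc 1 X)
    ⟨1, Finset.mem_Icc.mpr ⟨le_rfl, hX⟩⟩ fun k => k.divisors.card
  rw [Finset.mem_Icc] at hk
  rw [maxDivisors, hk']
  refine (h k hk.1).trans ?_
  gcongr
  exact hk.2

/-! ### Counting by partial information -/

section Fibers

variable {σ α : Type*}

/-- Every fibre of `F` on `S` has at most `K` elements. -/
def FiberBound (S : Finset σ) (F : σ → α) (K : ℕ) : Prop :=
  ∀ S' ⊆ S, (∀ s ∈ S', ∀ t ∈ S', F s = F t) → S'.card ≤ K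

theorem FiberBound.mono {S : Finset σ} {F : σ → α} {K K' : ℕ} (h : FiberBound S F K)
    (hK : K ≤ K') : FiberBound S F K' :=
  fun S' hS' hF => (h S' hS' hF).trans hK

theorem fiberBound_one {S : Finset σ} {F : σ → α}
    (h : ∀ s ∈ S, ∀ t ∈ S, F s = F t → s = t) : FiberBound S F 1 := by
  intro S' hS' hF
  exact Finset.card_le_one.mpr fun s hs t ht => h s (hS' hs) t (hS' ht) (hF s hs t ht)

/-- If `g` divides a number known from `F`, it can be added to the information in `F` at the cost
of a divisor function. -/
theorem FiberBound.of_dvd {X : ℕ} {S : Finset σ} {F : σ → α} {K : ℕ} (g R : σ → ℕ)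
    (hg : ∀ s ∈ S, g s ∣ R s ∧ 0 < R s ∧ R s ≤ X)
    (hR : ∀ s ∈ S, ∀ t ∈ S, F s = F t → R s = R t)
    (h : FiberBound S (fun s => (F s, g s)) K) : FiberBound S F (maxDivisors X * K) := by
  classical
  intro S' hS' hF
  rcases S'.eq_empty_or_nonempty with rfl | ⟨s₀, hs₀⟩
  · simp
  have hmaps : ∀ s ∈ S', g s ∈ (R s₀).divisors := fun s hs => by
    rw [Nat.mem_divisors, ← hR s (hS' hs) s₀ (hS' hs₀) (hF s hs s₀ hs₀)]
    exact ⟨(hg s (hS' hs)).1, (hg s (hS' hs)).2.1.ne'⟩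
  refine (Finset.card_le_mul_card_image_of_maps_to hmaps K fun c _ => ?_).trans ?_
  · refine h _ ((Finset.filter_subset _ _).trans hS') fun s hs t ht => ?_
    rw [Finset.mem_filter] at hs ht
    exact Prod.ext (hF s hs.1 t ht.1) (hs.2.trans ht.2.symm)
  · rw [mul_comm]
    exact Nat.mul_le_mul_right _
      (card_divisors_le_maxDivisors (hg s₀ (hS' hs₀)).2.1 (hg s₀ (hS' hs₀)).2.2)

theorem FiberBound.of_dvd_pair {X : ℕ} {S : Finset σ} {F : σ → α} {K : ℕ}
    (x y R : σ → ℕ) (hR : ∀ s ∈ S, R s = x s * y s ∧ 0 < R s ∧ R s ≤ X)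
    (hF : ∀ s ∈ S, ∀ t ∈ S, F s = F t → R s = R t)
    (h : FiberBound S (fun s => ((F s, x s), y s)) K) :
    FiberBound S F (maxDivisors X ^ 2 * K) := by
  rw [pow_two, mul_assoc]
  refine .of_dvd x R (fun s hs => ⟨Dvd.intro _ (hR s hs).1.symm, (hR s hs).2⟩) hF ?_
  exact .of_dvd y R (fun s hs => ⟨Dvd.intro_left _ (hR s hs).1.symm, (hR s hs).2⟩)
    (fun s hs t ht hst => hF s hs t ht (Prod.ext_iff.mp hst).1) h

/-- Simultaneous version of `FiberBound.of_dvd` for several divisors of the same number. -/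
theorem FiberBound.of_dvd_list {X : ℕ} {S : Finset σ} {K : ℕ} (R : σ → ℕ)
    (hR0 : ∀ s ∈ S, 0 < R s ∧ R s ≤ X) :
    ∀ (l : List (σ → ℕ)) {α : Type _} {F : σ → α}, (∀ s ∈ S, ∀ t ∈ S, F s = F t → R s = R t) →
      (∀ g ∈ l, ∀ s ∈ S, g s ∣ R s) →
      FiberBound S (fun s => (F s, l.map fun g => g s)) K →
      FiberBound S F (maxDivisors X ^ l.length * K)
  | [], α, F, _, _, h => by
      refine FiberBound.mono (K := K) (fun S' hS' hF => h S' hS' fun s hs t ht => ?_) (by simp)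
      simp [hF s hs t ht]
  | g :: l, α, F, hR, hl, h => by
      rw [List.length_cons, pow_succ', mul_assoc]
      refine .of_dvd g R (fun s hs => ⟨hl g (by simp) s hs, hR0 s hs⟩) hR ?_
      refine of_dvd_list R hR0 l (fun s hs t ht hst => hR s hs t ht (Prod.ext_iff.mp hst).1)
        (fun g' hg' => hl g' (by simp [hg'])) ?_
      intro S' hS' hF
      refine h S' hS' fun s hs t ht => ?_
      have := hF s hs t ht
      simp only [Prod.mk.injEq] at this
      simp [this]

/-- Multiplying the equation by `A` and completing the product exhibits `A x - C` as a divisor of `B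
C + A E`. Both truncated subtractions are genuine, as `C < A x` and `B ≤ A y`. The bound by a square
is the reason why the families below control squares. -/
theorem factor_bilinear {A B C E x y : ℕ} (hB : 0 < B) (hC : 0 < C) (hx : 0 < x)
    (h : A * x * y = B * x + C * y + E) :
    C < A * x ∧ (A * x - C) * (A * y - B) = B * C + A * E ∧ (A * x - C) * y = B * x + E ∧
      0 < B * C + A * E ∧ B * C + A * E ≤ (A * x * y) ^ 2 := by
  have h1 : C < A * x := by
    by_contra hh
    have := Nat.mul_le_mul_right y (not_lt.mp hh)
    have := Nat.mul_pos hB hx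
    omega
  have hy : 0 < y := by
    rcases Nat.eq_zero_or_pos y with rfl | hy
    · have := Nat.mul_pos hB hx
      omega
    · exact hy
  have hA : 0 < A := by
    rcases Nat.eq_zero_or_pos A with rfl | hA
    · omega
    · exact hA
  obtain ⟨p, hp⟩ := Nat.exists_eq_add_of_lt h1
  have h2 : (p + 1) * y = B * x + E := by
    have : A * x * y = C * y + (p + 1) * y := by rw [hp]; ring
    omega
  have h3 : B ≤ A * y := by
    have : B * x ≤ A * y * x := by
      calc B * x ≤ A * x * y := by omega
        _ = A * y * x := by ring
    exact Nat.le_of_mul_le_mul_right this hx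
  obtain ⟨q, hq⟩ := Nat.exists_eq_add_of_le h3
  have e1 : A * x - C = p + 1 := by omega
  have e2 : A * y - B = q := by omega
  have h4 : (p + 1) * q = B * C + A * E := by
    have : (p + 1) * (B + q) = A * (B * x + E) := by rw [← hq, ← h2]; ring
    have h5 : A * (B * x + E) = B * (C + p + 1) + A * E := by rw [← hp]; ring
    nlinarith
  refine ⟨h1, by rw [e1, e2, h4], by rw [e1, h2], ?_, ?_⟩
  · exact Nat.add_pos_left (Nat.mul_pos hB hC) _
  · calc B * C + A * E = (p + 1) * q := h4.symm
      _ ≤ (A * x) * (A * y) := Nat.mul_le_mul (by omega) (by omega)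
      _ ≤ (A * x * y) * (A * x * y) :=
          Nat.mul_le_mul (Nat.le_mul_of_pos_right _ hy) (Nat.mul_le_mul_right _ (Nat.le_mul_of_pos_right _ hx))
      _ = _ := by ring

/-- Two unknowns `x`, `y` satisfying a bilinear equation with known coefficients can be added to
the information in `F` at the cost of a divisor function. -/
theorem FiberBound.of_bilinear {X : ℕ} {S : Finset σ} {F : σ → α} {K : ℕ}
    (x y A B C E : σ → ℕ)
    (h0 : ∀ s ∈ S, 0 < B s ∧ 0 < C s ∧ 0 < x s)
    (heq : ∀ s ∈ S, A s * x s * y s = B s * x s + C s * y s + E s)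
    (hX : ∀ s ∈ S, (A s * x s * y s) ^ 2 ≤ X)
    (hA : ∀ s ∈ S, ∀ t ∈ S, F s = F t → A s = A t ∧ B s = B t ∧ C s = C t ∧ E s = E t)
    (h : FiberBound S (fun s => ((F s, x s), y s)) K) :
    FiberBound S F (maxDivisors X * K) := by
  have fac := fun s hs => factor_bilinear (h0 s hs).1 (h0 s hs).2.1 (h0 s hs).2.2 (heq s hs)
  refine FiberBound.of_dvd (fun s => A s * x s - C s) (fun s => B s * C s + A s * E s)
    (fun s hs => ⟨Dvd.intro _ (fac s hs).2.1, (fac s hs).2.2.2.1,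
      (fac s hs).2.2.2.2.trans (hX s hs)⟩) (fun s hs t ht hF => ?_) ?_
  · obtain ⟨h1, h2, h3, h4⟩ := hA s hs t ht hF
    simp only [h1, h2, h3, h4]
  -- The divisor `A x - C` gives `x`, since `A` and `C` are known, and then `(A x - C) y = B x + E`
  -- gives `y`.
  · intro S' hS' hF
    refine h S' hS' fun s hs t ht => ?_
    have hst := hF s hs t ht
    simp only [Prod.mk.injEq] at hst
    obtain ⟨hFst, hd⟩ := hst
    obtain ⟨h1, h2, h3, h4⟩ := hA s (hS' hs) t (hS' ht) hFst
    have fs := fac s (hS' hs)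
    have ft := fac t (hS' ht)
    have hApos : 0 < A t := by
      rcases Nat.eq_zero_or_pos (A t) with h | h
      · have := ft.1
        rw [h] at this
        omega
      · exact h
    have hx : x s = x t := by
      have e : A t * x s = A t * x t := by
        have f1 := fs.1
        have f2 := ft.1
        rw [h1, h3] at hd f1
        omega
      exact Nat.eq_of_mul_eq_mul_left hApos e
    have hy : y s = y t := by
      have e1 := fs.2.2.1
      have e2 := ft.2.2.1
      rw [hd, hx, h2, h4, ← e2] at e1
      exact Nat.eq_of_mul_eq_mul_left (by have := ft.1; omega) e1
    simp [hFst, hx, hy]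

/-- If a positive integer `g ≤ B` determines every element of `S` up to `K` choices then
`S` has at most `B * K` elements. -/
theorem FiberBound.card_le {S : Finset σ} {g : σ → ℕ} {K : ℕ} (h : FiberBound S g K) {B : ℝ}
    (hB : 0 ≤ B)
    (hg : ∀ s ∈ S, 0 < g s ∧ (g s : ℝ) ≤ B) : (S.card : ℝ) ≤ B * K := by
  classical
  have hmaps : ∀ s ∈ S, g s ∈ Finset.Icc 1 ⌊B⌋₊ := fun s hs =>
    Finset.mem_Icc.mpr ⟨(hg s hs).1, Nat.le_floor (hg s hs).2⟩
  have := Finset.card_le_mul_card_image_of_maps_to hmaps K fun c _ =>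
    h _ (Finset.filter_subset _ _) fun s hs t ht => by
      rw [Finset.mem_filter] at hs ht
      exact hs.2.trans ht.2.symm
  rw [Nat.card_Icc, Nat.add_sub_cancel] at this
  calc (S.card : ℝ) ≤ K * (⌊B⌋₊ : ℝ) := by exact_mod_cast this
    _ ≤ K * B := by gcongr; exact Nat.floor_le hB
    _ = B * K := mul_comm _ _

theorem FiberBound.subset {S S' : Finset σ} {F : σ → α} {K : ℕ} (h : FiberBound S F K)
    (hS : S' ⊆ S) : FiberBound S' F K :=
  fun T hT hF => h T (hT.trans hS) hF

/-- If for every element of `S` one of finitely many keys is at most `B`, and each key determines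
the elements of `S` up to `K` choices, then `S` has at most `k * B * K` elements. -/
theorem card_le_of_keys {k : ℕ} {S : Finset σ} {g : Fin k → σ → ℕ} {K : ℕ}
    (h : ∀ i, FiberBound S (g i) K) {B : ℝ} (hB : 0 ≤ B)
    (hg : ∀ s ∈ S, ∀ i, 0 < g i s) (hle : ∀ s ∈ S, ∃ i, (g i s : ℝ) ≤ B) :
    (S.card : ℝ) ≤ k * (B * K) := by
  classical
  have hsub : S ⊆ Finset.univ.biUnion fun i => S.filter fun s => (g i s : ℝ) ≤ B := by
    intro s hs
    obtain ⟨i, hi⟩ := hle s hs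
    simp only [Finset.mem_biUnion, Finset.mem_univ, true_and, Finset.mem_filter]
    exact ⟨i, hs, hi⟩
  calc (S.card : ℝ) ≤ ∑ i : Fin k, ((S.filter fun s => (g i s : ℝ) ≤ B).card : ℝ) := by
        exact_mod_cast (Finset.card_le_card hsub).trans Finset.card_biUnion_le
    _ ≤ ∑ _i : Fin k, B * K := Finset.sum_le_sum fun i _ =>
        ((h i).subset (Finset.filter_subset _ _)).card_le hB fun s hs => by
          rw [Finset.mem_filter] at hs
          exact ⟨hg s hs.1 i, hs.2⟩
    _ = k * (B * K) := by simp

end Fibers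

/-! ### Parametrizing sums of unit fractions -/

/-- Here `d i / t i` is `N / b i` in lowest terms and `L` is the lcm of the `t i`. If a prime `p`
divided every `y j` with `j ≠ i`, minimality of `L` would force `p ∤ y i`, hence `p ∣ t i` and `p ∤
d i`. But `p` divides `u L` and all the other terms, so it divides `d i y i`, a contradiction. -/
theorem exists_lcm_param {ι : Type*} [Fintype ι] [Nontrivial ι] {u N : ℕ}
    (hN : 0 < N) {b : ι → ℕ} (hb : ∀ i, 0 < b i) (h : (u : ℚ) / N = ∑ i, 1 / (b i : ℚ)) :
    ∃ (L : ℕ) (d t y : ι → ℕ), 0 < L ∧ u * L = ∑ i, d i * y i ∧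
      (∀ i, 0 < d i ∧ 0 < y i ∧ d i ∣ N ∧ t i * y i = L ∧ b i * d i = N * t i ∧
        (d i).Coprime (t i)) ∧
      (∀ p : ℕ, p.Prime → ∀ i, ∃ j, j ≠ i ∧ ¬ p ∣ y j) ∧ L ∣ ∏ i, b i := by
  classical
  set g : ι → ℕ := fun i => (b i).gcd N
  set t : ι → ℕ := fun i => b i / g i
  set d : ι → ℕ := fun i => N / g i
  have hg : ∀ i, 0 < g i := fun i => Nat.gcd_pos_of_pos_left _ (hb i)
  have hbt : ∀ i, b i = g i * t i := fun i => (Nat.mul_div_cancel' (Nat.gcd_dvd_left _ _)).symm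
  have hNd : ∀ i, N = g i * d i := fun i => (Nat.mul_div_cancel' (Nat.gcd_dvd_right _ _)).symm
  have ht : ∀ i, 0 < t i := fun i => Nat.pos_of_mul_pos_left (hbt i ▸ hb i)
  have hd : ∀ i, 0 < d i := fun i => Nat.pos_of_mul_pos_left (hNd i ▸ hN)
  have hcop : ∀ i, (d i).Coprime (t i) := fun i => (Nat.coprime_div_gcd_div_gcd (hg i)).symm
  set L : ℕ := Finset.univ.lcm t
  have htL : ∀ i, t i ∣ L := fun i => Finset.dvd_lcm (Finset.mem_univ i)
  have hL0 : L ≠ 0 := fun h0 => by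
    obtain ⟨i, -, hi⟩ := Finset.lcm_eq_zero_iff.mp h0
    exact (ht i).ne' hi
  have hL : 0 < L := Nat.pos_of_ne_zero hL0
  set y : ι → ℕ := fun i => L / t i
  have hty : ∀ i, t i * y i = L := fun i => Nat.mul_div_cancel' (htL i)
  have hy : ∀ i, 0 < y i := fun i => Nat.pos_of_mul_pos_left ((hty i).symm ▸ hL)
  have hsum : u * L = ∑ i, d i * y i := by
    have hNq : (N : ℚ) ≠ 0 := by exact_mod_cast hN.ne'
    have : (u : ℚ) * L = ∑ i, (d i : ℚ) * y i := by
      have hu : (u : ℚ) = N * ∑ i, 1 / (b i : ℚ) := by rw [← h]; field_simp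
      rw [hu, Finset.mul_sum, Finset.sum_mul]
      refine Finset.sum_congr rfl fun i _ => ?_
      have h1 : (g i : ℚ) ≠ 0 := by exact_mod_cast (hg i).ne'
      have h2 : (t i : ℚ) ≠ 0 := by exact_mod_cast (ht i).ne'
      have h3 : (b i : ℚ) = g i * t i := by exact_mod_cast hbt i
      have h4 : (N : ℚ) = g i * d i := by exact_mod_cast hNd i
      have h5 : (L : ℚ) = t i * y i := by exact_mod_cast (hty i).symm
      rw [h3, h4, h5]
      field_simp
    exact_mod_cast this
  refine ⟨L, d, t, y, hL, hsum, fun i => ⟨hd i, hy i, Dvd.intro_left _ (hNd i).symm, hty i,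
    ?_, hcop i⟩, ?_, ?_⟩
  · calc b i * d i = g i * d i * t i := by rw [hbt i]; ring
      _ = N * t i := by rw [← hNd i]
  · intro p hp i
    by_contra! hall
    obtain ⟨j, hj⟩ := exists_ne i
    have hpL : p ∣ L := (hall j hj).trans (Dvd.intro_left _ (hty j))
    have hyi : ¬ p ∣ y i := by
      intro hi
      have hall' : ∀ k, p ∣ y k := fun k => by
        by_cases hk : k = i
        · rwa [hk]
        · exact hall k hk
      -- If `p` divided all `y k`, then `L / p` would still be a common multiple of the `t k`.
      have h1 : L ∣ L / p := Finset.lcm_dvd fun k _ => by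
        obtain ⟨c, hc⟩ := hall' k
        refine ⟨c, ?_⟩
        rw [← hty k, hc]
        exact Nat.div_eq_of_eq_mul_left hp.pos (by ring)
      have h2 := Nat.le_of_dvd (Nat.div_pos (Nat.le_of_dvd hL hpL) hp.pos) h1
      exact absurd (Nat.div_lt_self hL hp.one_lt) (not_lt.mpr h2)
    have hti : p ∣ t i := by
      rcases hp.dvd_mul.mp ((hty i).symm ▸ hpL) with h | h
      · exact h
      · exact absurd h hyi
    have hdi : ¬ p ∣ d i := fun h' =>
      hp.one_lt.ne' (Nat.dvd_one.mp ((hcop i) ▸ Nat.dvd_gcd h' hti))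
    rw [← Finset.add_sum_erase _ _ (Finset.mem_univ i)] at hsum
    have h3 : p ∣ ∑ k ∈ Finset.univ.erase i, d k * y k :=
      Finset.dvd_sum fun k hk => (hall k (Finset.ne_of_mem_erase hk)).mul_left _
    have h4 : p ∣ d i * y i := (Nat.dvd_add_left h3).mp (hsum ▸ hpL.mul_left u)
    rcases hp.dvd_mul.mp h4 with h | h
    · exact hdi h
    · exact hyi h
  · exact Finset.lcm_dvd fun i _ =>
      (Dvd.intro_left _ (hbt i).symm).trans (Finset.dvd_prod_of_mem b (Finset.mem_univ i))

/-- Parameters for a representation of a fraction as a sum of three unit fractions. -/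
structure TripleParam where
  (d₁ d₂ d₃ y₁ y₂ y₃ w : ℕ)

namespace TripleParam

/-- The parameters describe the representation `u / N = 1 / b₁ + 1 / b₂ + 1 / b₃`. -/
structure Valid (p : TripleParam) (u N b₁ b₂ b₃ : ℕ) : Prop where
  dvd₁ : p.d₁ ∣ N
  dvd₂ : p.d₂ ∣ N
  dvd₃ : p.d₃ ∣ N
  y₁_pos : 0 < p.y₁
  y₂_pos : 0 < p.y₂
  y₃_pos : 0 < p.y₃
  w_pos : 0 < p.w
  eq : u * (p.w * p.y₁ * p.y₂ * p.y₃) = p.d₁ * p.y₁ + p.d₂ * p.y₂ + p.d₃ * p.y₃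
  eq₁ : b₁ * p.d₁ = N * (p.w * p.y₂ * p.y₃)
  eq₂ : b₂ * p.d₂ = N * (p.w * p.y₁ * p.y₃)
  eq₃ : b₃ * p.d₃ = N * (p.w * p.y₁ * p.y₂)
  coprime : p.d₁.Coprime p.y₃
  dvd_prod : p.w * p.y₁ * p.y₂ * p.y₃ ∣ b₁ * b₂ * b₃

/-- With three terms the prime condition says that the `y i` are pairwise coprime, so their product
divides `L`, and `w` is the cofactor. The coprimality of `d₁` and `y₃` is inherited from that of
`d₁` and `t₁`, a multiple of `y₃`. -/
theorem exists_valid {u N b₁ b₂ b₃ : ℕ} (hN : 0 < N) (h₁ : 0 < b₁) (h₂ : 0 < b₂) (h₃ : 0 < b₃)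
    (h : (u : ℚ) / N = 1 / (b₁ : ℚ) + 1 / b₂ + 1 / b₃) :
    ∃ p : TripleParam, p.Valid u N b₁ b₂ b₃ := by
  obtain ⟨L, d, t, y, hL, hsum, hi, hp, hprod⟩ := exists_lcm_param (u := u) (b := ![b₁, b₂, b₃]) hN
    (fun i => by fin_cases i <;> simpa) (by simpa [Fin.sum_univ_three] using h)
  obtain ⟨-, hy0, hd0, ht0, hb0, hc0⟩ := hi 0
  obtain ⟨-, hy1, hd1, ht1, hb1, -⟩ := hi 1
  obtain ⟨-, hy2, hd2, ht2, hb2, -⟩ := hi 2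
  have c01 : (y 0).Coprime (y 1) := Nat.coprime_of_dvd fun p pp h0 h1 => by
    obtain ⟨j, hj, hj'⟩ := hp p pp 2
    fin_cases j <;> simp_all
  have c02 : (y 0).Coprime (y 2) := Nat.coprime_of_dvd fun p pp h0 h1 => by
    obtain ⟨j, hj, hj'⟩ := hp p pp 1
    fin_cases j <;> simp_all
  have c12 : (y 1).Coprime (y 2) := Nat.coprime_of_dvd fun p pp h0 h1 => by
    obtain ⟨j, hj, hj'⟩ := hp p pp 0
    fin_cases j <;> simp_all
  obtain ⟨w, hw⟩ : y 0 * y 1 * y 2 ∣ L :=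
    Nat.Coprime.mul_dvd_of_dvd_of_dvd (Nat.Coprime.mul_left c02 c12)
      (Nat.Coprime.mul_dvd_of_dvd_of_dvd c01 (Dvd.intro_left _ ht0) (Dvd.intro_left _ ht1))
      (Dvd.intro_left _ ht2)
  have e0 : t 0 = w * y 1 * y 2 := Nat.eq_of_mul_eq_mul_right hy0 (by rw [ht0, hw]; ring)
  have e1 : t 1 = w * y 0 * y 2 := Nat.eq_of_mul_eq_mul_right hy1 (by rw [ht1, hw]; ring)
  have e2 : t 2 = w * y 0 * y 1 := Nat.eq_of_mul_eq_mul_right hy2 (by rw [ht2, hw]; ring)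
  have hw' : w * y 0 * y 1 * y 2 = L := by rw [hw]; ring
  refine ⟨⟨d 0, d 1, d 2, y 0, y 1, y 2, w⟩, hd0, hd1, hd2, hy0, hy1, hy2, ?_, ?_, ?_, ?_, ?_, ?_, ?_⟩
  · rcases Nat.eq_zero_or_pos w with rfl | h
    · simp at hw'; omega
    · exact h
  · simp only [hw', hsum, Fin.sum_univ_three]
  · simpa [e0] using hb0
  · simpa [e1] using hb1
  · simpa [e2] using hb2
  · exact Nat.Coprime.coprime_dvd_right (Dvd.intro_left _ e0.symm) hc0
  · simpa [hw', Fin.prod_univ_three] using hprod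

end TripleParam

/-- Parameters for a representation of a fraction as a sum of four unit fractions. -/
structure QuadParam where
  (d₁ d₂ d₃ d₄ h₁₂ h₁₃ h₁₄ h₂₃ h₂₄ h₃₄ s₁ s₂ s₃ s₄ w : ℕ)

namespace QuadParam

/-- The parameters describe the representation `m / n = 1 / a₁ + 1 / a₂ + 1 / a₃ + 1 / a₄`. -/
structure Valid (p : QuadParam) (m n a₁ a₂ a₃ a₄ : ℕ) : Prop where
  dvd₁ : p.d₁ ∣ n
  dvd₂ : p.d₂ ∣ n
  dvd₃ : p.d₃ ∣ n
  dvd₄ : p.d₄ ∣ n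
  h₁₂_pos : 0 < p.h₁₂
  h₁₃_pos : 0 < p.h₁₃
  h₁₄_pos : 0 < p.h₁₄
  h₂₃_pos : 0 < p.h₂₃
  h₂₄_pos : 0 < p.h₂₄
  h₃₄_pos : 0 < p.h₃₄
  s₁_pos : 0 < p.s₁
  s₂_pos : 0 < p.s₂
  s₃_pos : 0 < p.s₃
  s₄_pos : 0 < p.s₄
  w_pos : 0 < p.w
  eq : m * (p.w * p.h₁₂ * p.h₁₃ * p.h₁₄ * p.h₂₃ * p.h₂₄ * p.h₃₄ * p.s₁ * p.s₂ * p.s₃ * p.s₄) =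
    p.d₁ * (p.h₁₂ * p.h₁₃ * p.h₁₄ * p.s₁) + p.d₂ * (p.h₁₂ * p.h₂₃ * p.h₂₄ * p.s₂) +
    p.d₃ * (p.h₁₃ * p.h₂₃ * p.h₃₄ * p.s₃) + p.d₄ * (p.h₁₄ * p.h₂₄ * p.h₃₄ * p.s₄)
  eq₁ : a₁ * p.d₁ = n * (p.w * p.h₂₃ * p.h₂₄ * p.h₃₄ * p.s₂ * p.s₃ * p.s₄)
  eq₂ : a₂ * p.d₂ = n * (p.w * p.h₁₃ * p.h₁₄ * p.h₃₄ * p.s₁ * p.s₃ * p.s₄)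
  eq₃ : a₃ * p.d₃ = n * (p.w * p.h₁₂ * p.h₁₄ * p.h₂₄ * p.s₁ * p.s₂ * p.s₄)
  eq₄ : a₄ * p.d₄ = n * (p.w * p.h₁₂ * p.h₁₃ * p.h₂₃ * p.s₁ * p.s₂ * p.s₃)
  coprime₁ : p.h₁₂.Coprime p.h₃₄
  coprime₂ : p.h₁₄.Coprime p.h₂₃
  dvd_prod : p.w * p.h₁₂ * p.h₁₃ * p.h₁₄ * p.h₂₃ * p.h₂₄ * p.h₃₄ * p.s₁ * p.s₂ * p.s₃ * p.s₄ ∣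
    a₁ * a₂ * a₃ * a₄

end QuadParam

/-- If no prime divides three of `y`, `z₁`, `z₂`, `z₃`, the numbers `gcd y zᵢ` are pairwise coprime
and their product divides `y`. -/
theorem exists_eq_gcd_mul_gcd_mul_gcd_mul {y z₁ z₂ z₃ : ℕ}
    (h₁₂ : ∀ p : ℕ, p.Prime → p ∣ y → p ∣ z₁ → p ∣ z₂ → False)
    (h₁₃ : ∀ p : ℕ, p.Prime → p ∣ y → p ∣ z₁ → p ∣ z₃ → False)
    (h₂₃ : ∀ p : ℕ, p.Prime → p ∣ y → p ∣ z₂ → p ∣ z₃ → False) :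
    ∃ s, y = y.gcd z₁ * y.gcd z₂ * y.gcd z₃ * s := by
  have aux : ∀ {a b : ℕ}, (∀ p : ℕ, p.Prime → p ∣ y → p ∣ a → p ∣ b → False) →
      (y.gcd a).Coprime (y.gcd b) := fun h => Nat.coprime_of_dvd fun p pp h0 h1 =>
    h p pp (h0.trans (Nat.gcd_dvd_left _ _)) (h0.trans (Nat.gcd_dvd_right _ _))
      (h1.trans (Nat.gcd_dvd_right _ _))
  exact Nat.Coprime.mul_dvd_of_dvd_of_dvd (Nat.Coprime.mul_left (aux h₁₃) (aux h₂₃))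
    (Nat.Coprime.mul_dvd_of_dvd_of_dvd (aux h₁₂) (Nat.gcd_dvd_left _ _) (Nat.gcd_dvd_left _ _))
    (Nat.gcd_dvd_left _ _)

theorem mul_mul_dvd_of_coprime {h c e L : ℕ} (hc : h * c ∣ L) (he : h * e ∣ L)
    (hce : c.Coprime e) : h * c * e ∣ L := by
  have := Nat.lcm_dvd hc he
  rwa [Nat.lcm_mul_left, hce.lcm_eq_mul, ← mul_assoc] at this

theorem coprime_of_eq_gcd_mul {y z h c e : ℕ} (hy : 0 < y) (hh : h = y.gcd z) (hc : y = h * c)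
    (he : z = h * e) : c.Coprime e := by
  have h0 : 0 < h := hh ▸ Nat.gcd_pos_of_pos_left _ hy
  rw [hc, he, Nat.gcd_mul_left] at hh
  exact Nat.eq_of_mul_eq_mul_left h0 (by rw [← hh, mul_one])

/-- If no prime divides three of `y₁`, `y₂`, `y₃`, `y₄`, the product of the pairwise greatest
common divisors and of the remaining cofactors divides every common multiple. -/
theorem exists_pairwise_gcd_param {y₁ y₂ y₃ y₄ L : ℕ} (h₁ : 0 < y₁) (h₂ : 0 < y₂) (h₃ : 0 < y₃)
    (hL₁ : y₁ ∣ L) (hL₂ : y₂ ∣ L) (hL₃ : y₃ ∣ L) (hL₄ : y₄ ∣ L)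
    (c₁ : ∀ p : ℕ, p.Prime → p ∣ y₂ → p ∣ y₃ → p ∣ y₄ → False)
    (c₂ : ∀ p : ℕ, p.Prime → p ∣ y₁ → p ∣ y₃ → p ∣ y₄ → False)
    (c₃ : ∀ p : ℕ, p.Prime → p ∣ y₁ → p ∣ y₂ → p ∣ y₄ → False)
    (c₄ : ∀ p : ℕ, p.Prime → p ∣ y₁ → p ∣ y₂ → p ∣ y₃ → False) :
    ∃ h₁₂ h₁₃ h₁₄ h₂₃ h₂₄ h₃₄ s₁ s₂ s₃ s₄ w : ℕ,
      y₁ = h₁₂ * h₁₃ * h₁₄ * s₁ ∧ y₂ = h₁₂ * h₂₃ * h₂₄ * s₂ ∧ y₃ = h₁₃ * h₂₃ * h₃₄ * s₃ ∧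
      y₄ = h₁₄ * h₂₄ * h₃₄ * s₄ ∧ h₁₂.Coprime h₃₄ ∧ h₁₄.Coprime h₂₃ ∧
      L = w * h₁₂ * h₁₃ * h₁₄ * h₂₃ * h₂₄ * h₃₄ * s₁ * s₂ * s₃ * s₄ := by
  obtain ⟨s₁, hs₁⟩ := exists_eq_gcd_mul_gcd_mul_gcd_mul (y := y₁) (z₁ := y₂) (z₂ := y₃) (z₃ := y₄)
    c₄ c₃ c₂
  obtain ⟨s₂, hs₂⟩ := exists_eq_gcd_mul_gcd_mul_gcd_mul (y := y₂) (z₁ := y₁) (z₂ := y₃) (z₃ := y₄)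
    (fun p pp a b c => c₄ p pp b a c) (fun p pp a b c => c₃ p pp b a c) c₁
  obtain ⟨s₃, hs₃⟩ := exists_eq_gcd_mul_gcd_mul_gcd_mul (y := y₃) (z₁ := y₁) (z₂ := y₂) (z₃ := y₄)
    (fun p pp a b c => c₄ p pp b c a) (fun p pp a b c => c₂ p pp b a c)
    (fun p pp a b c => c₁ p pp b a c)
  obtain ⟨s₄, hs₄⟩ := exists_eq_gcd_mul_gcd_mul_gcd_mul (y := y₄) (z₁ := y₁) (z₂ := y₂) (z₃ := y₃)
    (fun p pp a b c => c₃ p pp b c a) (fun p pp a b c => c₂ p pp b c a)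
    (fun p pp a b c => c₁ p pp b c a)
  rw [Nat.gcd_comm y₂ y₁] at hs₂
  rw [Nat.gcd_comm y₃ y₁, Nat.gcd_comm y₃ y₂] at hs₃
  rw [Nat.gcd_comm y₄ y₁, Nat.gcd_comm y₄ y₂, Nat.gcd_comm y₄ y₃] at hs₄
  generalize e₁₂ : y₁.gcd y₂ = h₁₂ at hs₁ hs₂ hs₃ hs₄
  generalize e₁₃ : y₁.gcd y₃ = h₁₃ at hs₁ hs₂ hs₃ hs₄
  generalize e₁₄ : y₁.gcd y₄ = h₁₄ at hs₁ hs₂ hs₃ hs₄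
  generalize e₂₃ : y₂.gcd y₃ = h₂₃ at hs₁ hs₂ hs₃ hs₄
  generalize e₂₄ : y₂.gcd y₄ = h₂₄ at hs₁ hs₂ hs₃ hs₄
  generalize e₃₄ : y₃.gcd y₄ = h₃₄ at hs₁ hs₂ hs₃ hs₄
  have k₁₂ := coprime_of_eq_gcd_mul h₁ e₁₂.symm (c := h₁₃ * h₁₄ * s₁) (e := h₂₃ * h₂₄ * s₂)
    (hs₁.trans (by ring)) (hs₂.trans (by ring))
  have k₁₃ := coprime_of_eq_gcd_mul h₁ e₁₃.symm (c := h₁₂ * h₁₄ * s₁) (e := h₂₃ * h₃₄ * s₃)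
    (hs₁.trans (by ring)) (hs₃.trans (by ring))
  have k₁₄ := coprime_of_eq_gcd_mul h₁ e₁₄.symm (c := h₁₂ * h₁₃ * s₁) (e := h₂₄ * h₃₄ * s₄)
    (hs₁.trans (by ring)) (hs₄.trans (by ring))
  have k₂₃ := coprime_of_eq_gcd_mul h₂ e₂₃.symm (c := h₁₂ * h₂₄ * s₂) (e := h₁₃ * h₃₄ * s₃)
    (hs₂.trans (by ring)) (hs₃.trans (by ring))
  have k₂₄ := coprime_of_eq_gcd_mul h₂ e₂₄.symm (c := h₁₂ * h₂₃ * s₂) (e := h₁₄ * h₃₄ * s₄)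
    (hs₂.trans (by ring)) (hs₄.trans (by ring))
  have k₃₄ := coprime_of_eq_gcd_mul h₃ e₃₄.symm (c := h₁₃ * h₂₃ * s₃) (e := h₁₄ * h₂₄ * s₄)
    (hs₃.trans (by ring)) (hs₄.trans (by ring))
  -- The divisor of `L` obtained here is `lcm y₁ y₂`, and the next one is `lcm y₃ y₄`.
  have d₁₂ := mul_mul_dvd_of_coprime (h := h₁₂) (L := L)
    ((hs₁.trans (by ring : _ = h₁₂ * (h₁₃ * h₁₄ * s₁))) ▸ hL₁)
    ((hs₂.trans (by ring : _ = h₁₂ * (h₂₃ * h₂₄ * s₂))) ▸ hL₂) k₁₂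
  have d₃₄ := mul_mul_dvd_of_coprime (h := h₃₄) (L := L)
    ((hs₃.trans (by ring : _ = h₃₄ * (h₁₃ * h₂₃ * s₃))) ▸ hL₃)
    ((hs₄.trans (by ring : _ = h₃₄ * (h₁₄ * h₂₄ * s₄))) ▸ hL₄) k₃₄
  have n₁₂ : ∀ p : ℕ, p ∣ h₁₂ → p ∣ y₁ ∧ p ∣ y₂ := fun p h => Nat.dvd_gcd_iff.mp (e₁₂ ▸ h)
  have n₁₄ : ∀ p : ℕ, p ∣ h₁₄ → p ∣ y₁ ∧ p ∣ y₄ := fun p h => Nat.dvd_gcd_iff.mp (e₁₄ ▸ h)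
  have n₂₃ : ∀ p : ℕ, p ∣ h₂₃ → p ∣ y₂ ∧ p ∣ y₃ := fun p h => Nat.dvd_gcd_iff.mp (e₂₃ ▸ h)
  have n₃₄ : ∀ p : ℕ, p ∣ h₃₄ → p ∣ y₃ ∧ p ∣ y₄ := fun p h => Nat.dvd_gcd_iff.mp (e₃₄ ▸ h)
  have m₁ : ∀ p : ℕ, p ∣ s₁ → p ∣ y₁ := fun p h => h.trans (Dvd.intro_left _ hs₁.symm)
  have m₂ : ∀ p : ℕ, p ∣ s₂ → p ∣ y₂ := fun p h => h.trans (Dvd.intro_left _ hs₂.symm)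
  have m₃ : ∀ p : ℕ, p ∣ s₃ → p ∣ y₃ := fun p h => h.trans (Dvd.intro_left _ hs₃.symm)
  have m₄ : ∀ p : ℕ, p ∣ s₄ → p ∣ y₄ := fun p h => h.trans (Dvd.intro_left _ hs₄.symm)
  have coph : h₁₂.Coprime h₃₄ := Nat.coprime_of_dvd fun p pp h h' =>
    c₄ p pp (n₁₂ p h).1 (n₁₂ p h).2 (n₃₄ p h').1
  have coph' : h₁₄.Coprime h₂₃ := Nat.coprime_of_dvd fun p pp h h' =>
    c₄ p pp (n₁₄ p h).1 (n₂₃ p h').1 (n₂₃ p h').2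
  have a₁ : h₁₂.Coprime s₃ := Nat.coprime_of_dvd fun p pp h h' =>
    c₄ p pp (n₁₂ p h).1 (n₁₂ p h).2 (m₃ p h')
  have a₂ : h₁₂.Coprime s₄ := Nat.coprime_of_dvd fun p pp h h' =>
    c₃ p pp (n₁₂ p h).1 (n₁₂ p h).2 (m₄ p h')
  have a₃ : s₁.Coprime h₃₄ := Nat.coprime_of_dvd fun p pp h h' =>
    c₂ p pp (m₁ p h) (n₃₄ p h').1 (n₃₄ p h').2
  have a₄ : s₂.Coprime h₃₄ := Nat.coprime_of_dvd fun p pp h h' =>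
    c₁ p pp (m₂ p h) (n₃₄ p h').1 (n₃₄ p h').2
  -- The two lcms share the factor `h₁₃ h₁₄ h₂₃ h₂₄`. Coprimality of what remains lets them be
  -- merged into the full product.
  have cop : (h₁₂ * s₁ * s₂).Coprime (h₃₄ * s₃ * s₄) :=
    Nat.Coprime.mul_left
      (Nat.Coprime.mul_left
        (Nat.Coprime.mul_right (Nat.Coprime.mul_right coph a₁) a₂)
        (Nat.Coprime.mul_right (Nat.Coprime.mul_right a₃
          k₁₃.coprime_mul_left.coprime_mul_left_right) k₁₄.coprime_mul_left.coprime_mul_left_right))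
      (Nat.Coprime.mul_right (Nat.Coprime.mul_right a₄
        k₂₃.coprime_mul_left.coprime_mul_left_right) k₂₄.coprime_mul_left.coprime_mul_left_right)
  obtain ⟨w, hw⟩ := mul_mul_dvd_of_coprime (h := h₁₃ * h₁₄ * h₂₃ * h₂₄) (L := L)
    (by convert d₁₂ using 1; ring) (by convert d₃₄ using 1; ring) cop
  exact ⟨h₁₂, h₁₃, h₁₄, h₂₃, h₂₄, h₃₄, s₁, s₂, s₃, s₄, w, hs₁, hs₂, hs₃, hs₄, coph, coph',
    hw.trans (by ring)⟩

/-- With four terms the prime condition only says that no prime divides three of the `y i`.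
Splitting off the pairwise gcds then makes every `t i` a monomial in the parameters. -/
theorem QuadParam.exists_valid {m n a₁ a₂ a₃ a₄ : ℕ} (hn : 0 < n) (h₁ : 0 < a₁) (h₂ : 0 < a₂)
    (h₃ : 0 < a₃) (h₄ : 0 < a₄)
    (h : (m : ℚ) / n = 1 / (a₁ : ℚ) + 1 / a₂ + 1 / a₃ + 1 / a₄) :
    ∃ p : QuadParam, p.Valid m n a₁ a₂ a₃ a₄ := by
  obtain ⟨L, d, t, y, hL, hsum, hi, hp, hprod⟩ := exists_lcm_param (u := m) (b := ![a₁, a₂, a₃, a₄])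
    hn (fun i => by fin_cases i <;> simpa) (by simpa [Fin.sum_univ_four] using h)
  obtain ⟨-, hy0, hd0, ht0, hb0, -⟩ := hi 0
  obtain ⟨-, hy1, hd1, ht1, hb1, -⟩ := hi 1
  obtain ⟨-, hy2, hd2, ht2, hb2, -⟩ := hi 2
  obtain ⟨-, hy3, hd3, ht3, hb3, -⟩ := hi 3
  obtain ⟨h₁₂, h₁₃, h₁₄, h₂₃, h₂₄, h₃₄, s₁, s₂, s₃, s₄, w, e₁, e₂, e₃, e₄, cop, cop', hLw⟩ :=
    exists_pairwise_gcd_param hy0 hy1 hy2 (Dvd.intro_left _ ht0) (Dvd.intro_left _ ht1)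
      (Dvd.intro_left _ ht2) (Dvd.intro_left _ ht3)
      (fun p pp _ _ _ => by obtain ⟨j, hj, hj'⟩ := hp p pp 0; fin_cases j <;> simp_all)
      (fun p pp _ _ _ => by obtain ⟨j, hj, hj'⟩ := hp p pp 1; fin_cases j <;> simp_all)
      (fun p pp _ _ _ => by obtain ⟨j, hj, hj'⟩ := hp p pp 2; fin_cases j <;> simp_all)
      (fun p pp _ _ _ => by obtain ⟨j, hj, hj'⟩ := hp p pp 3; fin_cases j <;> simp_all)
  have t0 : t 0 = w * h₂₃ * h₂₄ * h₃₄ * s₂ * s₃ * s₄ :=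
    Nat.eq_of_mul_eq_mul_right hy0 (by rw [ht0, hLw, e₁]; ring)
  have t1 : t 1 = w * h₁₃ * h₁₄ * h₃₄ * s₁ * s₃ * s₄ :=
    Nat.eq_of_mul_eq_mul_right hy1 (by rw [ht1, hLw, e₂]; ring)
  have t2 : t 2 = w * h₁₂ * h₁₄ * h₂₄ * s₁ * s₂ * s₄ :=
    Nat.eq_of_mul_eq_mul_right hy2 (by rw [ht2, hLw, e₃]; ring)
  have t3 : t 3 = w * h₁₂ * h₁₃ * h₂₃ * s₁ * s₂ * s₃ :=
    Nat.eq_of_mul_eq_mul_right hy3 (by rw [ht3, hLw, e₄]; ring)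
  have hpos := hL
  rw [hLw] at hpos
  simp only [Nat.pos_iff_ne_zero, mul_ne_zero_iff] at hpos
  obtain ⟨⟨⟨⟨⟨⟨⟨⟨⟨⟨p0, p1⟩, p2⟩, p3⟩, p4⟩, p5⟩, p6⟩, p7⟩, p8⟩, p9⟩, p10⟩ := hpos
  exact ⟨⟨d 0, d 1, d 2, d 3, h₁₂, h₁₃, h₁₄, h₂₃, h₂₄, h₃₄, s₁, s₂, s₃, s₄, w⟩,
    { dvd₁ := hd0
      dvd₂ := hd1
      dvd₃ := hd2
      dvd₄ := hd3
      h₁₂_pos := Nat.pos_of_ne_zero p1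
      h₁₃_pos := Nat.pos_of_ne_zero p2
      h₁₄_pos := Nat.pos_of_ne_zero p3
      h₂₃_pos := Nat.pos_of_ne_zero p4
      h₂₄_pos := Nat.pos_of_ne_zero p5
      h₃₄_pos := Nat.pos_of_ne_zero p6
      s₁_pos := Nat.pos_of_ne_zero p7
      s₂_pos := Nat.pos_of_ne_zero p8
      s₃_pos := Nat.pos_of_ne_zero p9
      s₄_pos := Nat.pos_of_ne_zero p10
      w_pos := Nat.pos_of_ne_zero p0
      eq := by simp only [← hLw, hsum, Fin.sum_univ_four, e₁, e₂, e₃, e₄]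
      eq₁ := by simpa [t0] using hb0
      eq₂ := by simpa [t1] using hb1
      eq₃ := by simpa [t2] using hb2
      eq₄ := by simpa [t3] using hb3
      coprime₁ := cop
      coprime₂ := cop'
      dvd_prod := by simpa [← hLw, Fin.prod_univ_four] using hprod }⟩

/-! ### Counting sums of three unit fractions -/

namespace TripleParam

/-- The quotient `(d₂ * y₂ + d₃ * y₃) / y₁`. -/
def quot₁ (p : TripleParam) : ℕ := (p.d₂ * p.y₂ + p.d₃ * p.y₃) / p.y₁

/-- The quotient `(d₁ * y₁ + d₂ * y₂) / (gcd d₁ d₂ * y₃)`. -/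
def quot₃ (p : TripleParam) : ℕ :=
  (p.d₁ / p.d₁.gcd p.d₂ * p.y₁ + p.d₂ / p.d₁.gcd p.d₂ * p.y₂) / p.y₃

namespace Valid

variable {p : TripleParam} {u N b₁ b₂ b₃ : ℕ}

theorem d₁_pos (h : p.Valid u N b₁ b₂ b₃) (hN : 0 < N) : 0 < p.d₁ := Nat.pos_of_dvd_of_pos h.dvd₁ hN

theorem d₂_pos (h : p.Valid u N b₁ b₂ b₃) (hN : 0 < N) : 0 < p.d₂ := Nat.pos_of_dvd_of_pos h.dvd₂ hN

theorem d₃_pos (h : p.Valid u N b₁ b₂ b₃) (hN : 0 < N) : 0 < p.d₃ := Nat.pos_of_dvd_of_pos h.dvd₃ hN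

theorem y₁_dvd (h : p.Valid u N b₁ b₂ b₃) : p.y₁ ∣ p.d₂ * p.y₂ + p.d₃ * p.y₃ := by
  have h1 : p.y₁ ∣ p.d₁ * p.y₁ + (p.d₂ * p.y₂ + p.d₃ * p.y₃) :=
    ⟨u * (p.w * p.y₂ * p.y₃), by rw [← add_assoc, ← h.eq]; ring⟩
  exact (Nat.dvd_add_right (Dvd.intro_left _ rfl)).mp h1

theorem y₃_dvd (h : p.Valid u N b₁ b₂ b₃) : p.y₃ ∣ p.d₁ * p.y₁ + p.d₂ * p.y₂ := by
  have h1 : p.y₃ ∣ p.d₁ * p.y₁ + p.d₂ * p.y₂ + p.d₃ * p.y₃ :=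
    ⟨u * (p.w * p.y₁ * p.y₂), by rw [← h.eq]; ring⟩
  exact (Nat.dvd_add_left (Dvd.intro_left _ rfl)).mp h1

theorem y₁_mul_quot₁ (h : p.Valid u N b₁ b₂ b₃) :
    p.y₁ * p.quot₁ = p.d₂ * p.y₂ + p.d₃ * p.y₃ :=
  Nat.mul_div_cancel' h.y₁_dvd

/-- This is the defining equation divided by `y₁`. Once `quot₁` and `d₁` are known, `w`, `y₂`, `y₃`
are divisors of a known number. -/
theorem quot₁_add (h : p.Valid u N b₁ b₂ b₃) : p.quot₁ + p.d₁ = u * (p.w * p.y₂ * p.y₃) := by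
  refine Nat.eq_of_mul_eq_mul_left h.y₁_pos ?_
  rw [mul_add, h.y₁_mul_quot₁]
  calc _ = p.d₁ * p.y₁ + p.d₂ * p.y₂ + p.d₃ * p.y₃ := by ring
    _ = _ := by rw [← h.eq]; ring

/-- Since `y₃` is coprime to `d₁`, it still divides after `gcd d₁ d₂` is removed. This saving later
replaces `d₁ d₂` by `lcm d₁ d₂ ≤ N`. -/
theorem y₃_mul_quot₃ (h : p.Valid u N b₁ b₂ b₃) :
    p.y₃ * p.quot₃ = p.d₁ / p.d₁.gcd p.d₂ * p.y₁ + p.d₂ / p.d₁.gcd p.d₂ * p.y₂ := by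
  refine Nat.mul_div_cancel' ?_
  have h1 : p.d₁.gcd p.d₂ *
      (p.d₁ / p.d₁.gcd p.d₂ * p.y₁ + p.d₂ / p.d₁.gcd p.d₂ * p.y₂) =
      p.d₁ * p.y₁ + p.d₂ * p.y₂ := by
    rw [mul_add, ← mul_assoc, ← mul_assoc, Nat.mul_div_cancel' (Nat.gcd_dvd_left _ _),
      Nat.mul_div_cancel' (Nat.gcd_dvd_right _ _)]
  have h2 : (p.y₃).Coprime (p.d₁.gcd p.d₂) :=
    (h.coprime.coprime_dvd_left (Nat.gcd_dvd_left _ _)).symm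
  exact h2.dvd_of_dvd_mul_left (h1 ▸ h.y₃_dvd)

theorem gcd_mul_quot₃_add (h : p.Valid u N b₁ b₂ b₃) :
    p.d₁.gcd p.d₂ * p.quot₃ + p.d₃ = u * (p.w * p.y₁ * p.y₂) := by
  refine Nat.eq_of_mul_eq_mul_left h.y₃_pos ?_
  have h1 : p.y₃ * (p.d₁.gcd p.d₂ * p.quot₃) = p.d₁ * p.y₁ + p.d₂ * p.y₂ := by
    rw [mul_left_comm, h.y₃_mul_quot₃, mul_add, ← mul_assoc, ← mul_assoc,
      Nat.mul_div_cancel' (Nat.gcd_dvd_left _ _), Nat.mul_div_cancel' (Nat.gcd_dvd_right _ _)]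
  rw [mul_add, h1]
  calc _ = p.d₁ * p.y₁ + p.d₂ * p.y₂ + p.d₃ * p.y₃ := by ring
    _ = _ := by rw [← h.eq]; ring

theorem quot₁_pos (h : p.Valid u N b₁ b₂ b₃) (hN : 0 < N) : 0 < p.quot₁ := by
  refine Nat.pos_of_mul_pos_left (a := p.y₁) ?_
  rw [h.y₁_mul_quot₁]
  exact Nat.add_pos_left (Nat.mul_pos (h.d₂_pos hN) h.y₂_pos) _

theorem quot₃_pos (h : p.Valid u N b₁ b₂ b₃) (hN : 0 < N) : 0 < p.quot₃ := by
  refine Nat.pos_of_mul_pos_left (a := p.y₃) ?_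
  rw [h.y₃_mul_quot₃]
  have : 0 < p.d₁ / p.d₁.gcd p.d₂ := Nat.div_pos
    (Nat.le_of_dvd (h.d₁_pos hN) (Nat.gcd_dvd_left _ _)) (Nat.gcd_pos_of_pos_left _ (h.d₁_pos hN))
  exact Nat.add_pos_left (Nat.mul_pos this h.y₁_pos) _

end Valid

end TripleParam

/-- A finite family of parametrized sums of three unit fractions, with all parameters controlled by
`X`. -/
structure TripleFamily {σ : Type*} (S : Finset σ) (u N b₁ b₂ b₃ : σ → ℕ) (p : σ → TripleParam)
    (X : ℕ) : Prop where
  valid : ∀ s ∈ S, (p s).Valid (u s) (N s) (b₁ s) (b₂ s) (b₃ s)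
  u_pos : ∀ s ∈ S, 0 < u s
  N_pos : ∀ s ∈ S, 0 < N s
  N_le : ∀ s ∈ S, N s ≤ X
  sq_le : ∀ s ∈ S, (u s * ((p s).w * (p s).y₁ * (p s).y₂ * (p s).y₃)) ^ 2 ≤ X
  inj : ∀ s ∈ S, ∀ t ∈ S, u s = u t → N s = N t → b₁ s = b₁ t → b₂ s = b₂ t → b₃ s = b₃ t → s = t

namespace TripleFamily

variable {σ α : Type*} {S : Finset σ} {u N b₁ b₂ b₃ : σ → ℕ} {p : σ → TripleParam} {X : ℕ}
  {F : σ → α} {K : ℕ}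

theorem le_X (h : TripleFamily S u N b₁ b₂ b₃ p X) {s : σ} (hs : s ∈ S) {k : ℕ}
    (hk : k ≤ u s * ((p s).w * (p s).y₁ * (p s).y₂ * (p s).y₃)) : k ≤ X :=
  (hk.trans (Nat.le_self_pow two_ne_zero _)).trans (h.sq_le s hs)

theorem fiberBound_one (h : TripleFamily S u N b₁ b₂ b₃ p X)
    (hF : ∀ s ∈ S, ∀ t ∈ S, F s = F t → u s = u t ∧ N s = N t ∧ p s = p t) :
    FiberBound S F 1 := by
  refine _root_.fiberBound_one fun s hs t ht hst => ?_
  obtain ⟨hu, hN, hp⟩ := hF s hs t ht hst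
  have vs := h.valid s hs
  have vt := h.valid t ht
  rw [hp, hN] at vs
  refine h.inj s hs t ht hu hN ?_ ?_ ?_
  · exact Nat.eq_of_mul_eq_mul_right (vt.d₁_pos (h.N_pos t ht)) (vs.eq₁.trans vt.eq₁.symm)
  · exact Nat.eq_of_mul_eq_mul_right (vt.d₂_pos (h.N_pos t ht)) (vs.eq₂.trans vt.eq₂.symm)
  · exact Nat.eq_of_mul_eq_mul_right (vt.d₃_pos (h.N_pos t ht)) (vs.eq₃.trans vt.eq₃.symm)

theorem of_d (h : TripleFamily S u N b₁ b₂ b₃ p X)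
    (hN : ∀ s ∈ S, ∀ t ∈ S, F s = F t → N s = N t)
    (hK : FiberBound S (fun s => (((F s, (p s).d₁), (p s).d₂), (p s).d₃)) K) :
    FiberBound S F (maxDivisors X ^ 3 * K) := by
  have e : maxDivisors X ^ 3 * K =
      maxDivisors X * (maxDivisors X * (maxDivisors X * K)) := by ring
  rw [e]
  refine .of_dvd (fun s => (p s).d₁) N
    (fun s hs => ⟨(h.valid s hs).dvd₁, h.N_pos s hs, h.N_le s hs⟩) hN ?_
  refine .of_dvd (fun s => (p s).d₂) N
    (fun s hs => ⟨(h.valid s hs).dvd₂, h.N_pos s hs, h.N_le s hs⟩)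
    (fun s hs t ht hst => hN s hs t ht (Prod.ext_iff.mp hst).1) ?_
  exact .of_dvd (fun s => (p s).d₃) N
    (fun s hs => ⟨(h.valid s hs).dvd₃, h.N_pos s hs, h.N_le s hs⟩)
    (fun s hs t ht hst => hN s hs t ht (Prod.ext_iff.mp (Prod.ext_iff.mp hst).1).1) hK

/-- Three divisor functions pay for the `d i` and a fourth for `y₁ ∣ d₂ y₂ + d₃ y₃`. The equation
then gives `w`. -/
theorem fiberBound_y₂_y₃ (h : TripleFamily S u N b₁ b₂ b₃ p X)
    (hF : ∀ s ∈ S, ∀ t ∈ S, F s = F t →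
      u s = u t ∧ N s = N t ∧ (p s).y₂ = (p t).y₂ ∧ (p s).y₃ = (p t).y₃) :
    FiberBound S F (maxDivisors X ^ 4) := by
  rw [show maxDivisors X ^ 4 = maxDivisors X ^ 3 * (maxDivisors X * 1) by ring]
  refine h.of_d (fun s hs t ht hst => (hF s hs t ht hst).2.1) ?_
  refine .of_dvd (fun s => (p s).y₁) (fun s => (p s).d₂ * (p s).y₂ + (p s).d₃ * (p s).y₃)
    (fun s hs => ⟨(h.valid s hs).y₁_dvd, ?_, h.le_X hs ?_⟩) (fun s hs t ht hst => ?_) ?_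
  · exact Nat.add_pos_left
      (Nat.mul_pos ((h.valid s hs).d₂_pos (h.N_pos s hs)) (h.valid s hs).y₂_pos) _
  · rw [(h.valid s hs).eq]
    omega
  · simp only [Prod.mk.injEq] at hst
    obtain ⟨⟨⟨hst, -⟩, e2⟩, e3⟩ := hst
    obtain ⟨-, -, e4, e5⟩ := hF s hs t ht hst
    simp only [e2, e3, e4, e5]
  · refine h.fiberBound_one fun s hs t ht hst => ?_
    simp only [Prod.mk.injEq] at hst
    obtain ⟨⟨⟨⟨hst, e1⟩, e2⟩, e3⟩, e6⟩ := hst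
    obtain ⟨hu, hN, e4, e5⟩ := hF s hs t ht hst
    refine ⟨hu, hN, ?_⟩
    have vs := (h.valid s hs).eq
    have vt := h.valid t ht
    rw [e1, e2, e3, e4, e5, e6, hu, ← vt.eq] at vs
    have hpos : 0 < u t * ((p t).y₁ * (p t).y₂ * (p t).y₃) :=
      Nat.mul_pos (h.u_pos t ht) (Nat.mul_pos (Nat.mul_pos vt.y₁_pos vt.y₂_pos) vt.y₃_pos)
    have e7 : (p s).w = (p t).w := Nat.eq_of_mul_eq_mul_right hpos (by linarith)
    cases hs' : p s
    cases ht' : p t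
    simp_all

/-- With the `d i`, `y₂` and `w` fixed, the equation is bilinear in `y₁` and `y₃`. -/
theorem fiberBound_y₂_w (h : TripleFamily S u N b₁ b₂ b₃ p X)
    (hF : ∀ s ∈ S, ∀ t ∈ S, F s = F t →
      u s = u t ∧ N s = N t ∧ (p s).y₂ = (p t).y₂ ∧ (p s).w = (p t).w) :
    FiberBound S F (maxDivisors X ^ 4) := by
  rw [show maxDivisors X ^ 4 = maxDivisors X ^ 3 * (maxDivisors X * 1) by ring]
  refine h.of_d (fun s hs t ht hst => (hF s hs t ht hst).2.1) ?_
  have e : ∀ s, u s * (p s).w * (p s).y₂ * (p s).y₁ * (p s).y₃ =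
    u s * ((p s).w * (p s).y₁ * (p s).y₂ * (p s).y₃) := fun s => by ring
  refine .of_bilinear (fun s => (p s).y₁) (fun s => (p s).y₃) (fun s => u s * (p s).w * (p s).y₂)
    (fun s => (p s).d₁) (fun s => (p s).d₃) (fun s => (p s).d₂ * (p s).y₂)
    (fun s hs => ⟨(h.valid s hs).d₁_pos (h.N_pos s hs), (h.valid s hs).d₃_pos (h.N_pos s hs),
      (h.valid s hs).y₁_pos⟩) (fun s hs => ?_) (fun s hs => ?_) (fun s hs t ht hst => ?_) ?_
  · simp only [e, (h.valid s hs).eq]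
    ring
  · simpa only [e] using h.sq_le s hs
  · simp only [Prod.mk.injEq] at hst
    obtain ⟨⟨⟨hst, e1⟩, e2⟩, e3⟩ := hst
    obtain ⟨hu, -, e4, e5⟩ := hF s hs t ht hst
    simp only [hu, e1, e2, e3, e4, e5, and_self]
  · refine h.fiberBound_one fun s hs t ht hst => ?_
    simp only [Prod.mk.injEq] at hst
    obtain ⟨⟨⟨⟨⟨hst, e1⟩, e2⟩, e3⟩, e6⟩, e7⟩ := hst
    obtain ⟨hu, hN, e4, e5⟩ := hF s hs t ht hst
    refine ⟨hu, hN, ?_⟩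
    cases hs' : p s
    cases ht' : p t
    simp_all

theorem fiberBound_y₃_w (h : TripleFamily S u N b₁ b₂ b₃ p X)
    (hF : ∀ s ∈ S, ∀ t ∈ S, F s = F t →
      u s = u t ∧ N s = N t ∧ (p s).y₃ = (p t).y₃ ∧ (p s).w = (p t).w) :
    FiberBound S F (maxDivisors X ^ 4) := by
  rw [show maxDivisors X ^ 4 = maxDivisors X ^ 3 * (maxDivisors X * 1) by ring]
  refine h.of_d (fun s hs t ht hst => (hF s hs t ht hst).2.1) ?_
  have e : ∀ s, u s * (p s).w * (p s).y₃ * (p s).y₁ * (p s).y₂ =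
    u s * ((p s).w * (p s).y₁ * (p s).y₂ * (p s).y₃) := fun s => by ring
  refine .of_bilinear (fun s => (p s).y₁) (fun s => (p s).y₂) (fun s => u s * (p s).w * (p s).y₃)
    (fun s => (p s).d₁) (fun s => (p s).d₂) (fun s => (p s).d₃ * (p s).y₃)
    (fun s hs => ⟨(h.valid s hs).d₁_pos (h.N_pos s hs), (h.valid s hs).d₂_pos (h.N_pos s hs),
      (h.valid s hs).y₁_pos⟩) (fun s hs => ?_) (fun s hs => ?_) (fun s hs t ht hst => ?_) ?_
  · simp only [e, (h.valid s hs).eq]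
  · simpa only [e] using h.sq_le s hs
  · simp only [Prod.mk.injEq] at hst
    obtain ⟨⟨⟨hst, e1⟩, e2⟩, e3⟩ := hst
    obtain ⟨hu, -, e4, e5⟩ := hF s hs t ht hst
    simp only [hu, e1, e2, e3, e4, e5, and_self]
  · refine h.fiberBound_one fun s hs t ht hst => ?_
    simp only [Prod.mk.injEq] at hst
    obtain ⟨⟨⟨⟨⟨hst, e1⟩, e2⟩, e3⟩, e6⟩, e7⟩ := hst
    obtain ⟨hu, hN, e4, e5⟩ := hF s hs t ht hst
    refine ⟨hu, hN, ?_⟩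
    cases hs' : p s
    cases ht' : p t
    simp_all

/-- After the `d i`, three more divisor functions give `w`, `y₂`, `y₃` as divisors of `quot₁ + d₁`,
and `y₁ quot₁ = d₂ y₂ + d₃ y₃` gives `y₁`. -/
theorem fiberBound_quot₁ (h : TripleFamily S u N b₁ b₂ b₃ p X)
    (hF : ∀ s ∈ S, ∀ t ∈ S, F s = F t → u s = u t ∧ N s = N t ∧ (p s).quot₁ = (p t).quot₁) :
    FiberBound S F (maxDivisors X ^ 6) := by
  rw [show maxDivisors X ^ 6 =
    maxDivisors X ^ 3 * (maxDivisors X * (maxDivisors X * (maxDivisors X * 1))) by ring]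
  refine h.of_d (fun s hs t ht hst => (hF s hs t ht hst).2.1) ?_
  have hR : ∀ s ∈ S, 0 < (p s).quot₁ + (p s).d₁ ∧ (p s).quot₁ + (p s).d₁ ≤ X := fun s hs => by
    refine ⟨Nat.add_pos_left ((h.valid s hs).quot₁_pos (h.N_pos s hs)) _, h.le_X hs ?_⟩
    rw [(h.valid s hs).quot₁_add]
    refine Nat.mul_le_mul_left _ ?_
    calc (p s).w * (p s).y₂ * (p s).y₃ ≤ (p s).w * (p s).y₂ * (p s).y₃ * (p s).y₁ :=
          Nat.le_mul_of_pos_right _ (h.valid s hs).y₁_pos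
      _ = _ := by ring
  refine .of_dvd (fun s => (p s).w) (fun s => (p s).quot₁ + (p s).d₁)
    (fun s hs => ⟨?_, hR s hs⟩) (fun s hs t ht hst => ?_) ?_
  · rw [(h.valid s hs).quot₁_add]
    exact ⟨u s * ((p s).y₂ * (p s).y₃), by ring⟩
  · grind
  refine .of_dvd (fun s => (p s).y₂) (fun s => (p s).quot₁ + (p s).d₁)
    (fun s hs => ⟨?_, hR s hs⟩) (fun s hs t ht hst => ?_) ?_
  · rw [(h.valid s hs).quot₁_add]
    exact ⟨u s * ((p s).w * (p s).y₃), by ring⟩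
  · grind
  refine .of_dvd (fun s => (p s).y₃) (fun s => (p s).quot₁ + (p s).d₁)
    (fun s hs => ⟨?_, hR s hs⟩) (fun s hs t ht hst => ?_) ?_
  · rw [(h.valid s hs).quot₁_add]
    exact ⟨u s * ((p s).w * (p s).y₂), by ring⟩
  · grind
  refine h.fiberBound_one fun s hs t ht hst => ?_
  simp only [Prod.mk.injEq] at hst
  obtain ⟨⟨⟨⟨⟨⟨hst, e1⟩, e2⟩, e3⟩, e4⟩, e5⟩, e6⟩ := hst
  obtain ⟨hu, hN, e7⟩ := hF s hs t ht hst
  refine ⟨hu, hN, ?_⟩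
  have vs := (h.valid s hs).y₁_mul_quot₁
  have vt := h.valid t ht
  rw [e7, e2, e3, e5, e6, ← vt.y₁_mul_quot₁] at vs
  have e8 := Nat.eq_of_mul_eq_mul_right (vt.quot₁_pos (h.N_pos t ht)) vs
  cases hs' : p s
  cases ht' : p t
  simp_all

theorem fiberBound_quot₃ (h : TripleFamily S u N b₁ b₂ b₃ p X)
    (hF : ∀ s ∈ S, ∀ t ∈ S, F s = F t → u s = u t ∧ N s = N t ∧ (p s).quot₃ = (p t).quot₃) :
    FiberBound S F (maxDivisors X ^ 6) := by
  rw [show maxDivisors X ^ 6 =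
    maxDivisors X ^ 3 * (maxDivisors X * (maxDivisors X * (maxDivisors X * 1))) by ring]
  refine h.of_d (fun s hs t ht hst => (hF s hs t ht hst).2.1) ?_
  set R : σ → ℕ := fun s => (p s).d₁.gcd (p s).d₂ * (p s).quot₃ + (p s).d₃
  have hR' : ∀ s ∈ S, R s = u s * ((p s).w * (p s).y₁ * (p s).y₂) := fun s hs =>
    (h.valid s hs).gcd_mul_quot₃_add
  have hR : ∀ s ∈ S, 0 < R s ∧ R s ≤ X := fun s hs => by
    refine ⟨Nat.add_pos_right _ ((h.valid s hs).d₃_pos (h.N_pos s hs)), h.le_X hs ?_⟩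
    rw [hR' s hs]
    exact Nat.mul_le_mul_left _ (Nat.le_mul_of_pos_right _ (h.valid s hs).y₃_pos)
  refine .of_dvd (fun s => (p s).w) R
    (fun s hs => ⟨?_, hR s hs⟩) (fun s hs t ht hst => ?_) ?_
  · rw [hR' s hs]
    exact ⟨u s * ((p s).y₁ * (p s).y₂), by ring⟩
  · grind
  refine .of_dvd (fun s => (p s).y₁) R
    (fun s hs => ⟨?_, hR s hs⟩) (fun s hs t ht hst => ?_) ?_
  · rw [hR' s hs]
    exact ⟨u s * ((p s).w * (p s).y₂), by ring⟩
  · grind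
  refine .of_dvd (fun s => (p s).y₂) R
    (fun s hs => ⟨?_, hR s hs⟩) (fun s hs t ht hst => ?_) ?_
  · rw [hR' s hs]
    exact ⟨u s * ((p s).w * (p s).y₁), by ring⟩
  · grind
  refine h.fiberBound_one fun s hs t ht hst => ?_
  simp only [Prod.mk.injEq] at hst
  obtain ⟨⟨⟨⟨⟨⟨hst, e1⟩, e2⟩, e3⟩, e4⟩, e5⟩, e6⟩ := hst
  obtain ⟨hu, hN, e7⟩ := hF s hs t ht hst
  refine ⟨hu, hN, ?_⟩
  have vs := (h.valid s hs).y₃_mul_quot₃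
  have vt := h.valid t ht
  rw [e7, e1, e2, e5, e6, ← vt.y₃_mul_quot₃] at vs
  have e8 := Nat.eq_of_mul_eq_mul_right (vt.quot₃_pos (h.N_pos t ht)) vs
  cases hs' : p s
  cases ht' : p t
  simp_all

end TripleFamily

/-! ### Counting sums of four unit fractions -/

namespace QuadParam

/-- The product of all parameters apart from the `dᵢ`. -/
def prod (p : QuadParam) : ℕ :=
  p.w * p.h₁₂ * p.h₁₃ * p.h₁₄ * p.h₂₃ * p.h₂₄ * p.h₃₄ * p.s₁ * p.s₂ * p.s₃ * p.s₄

/-- All parameters apart from `h₁₄`, `h₂₃`, `s₁`. -/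
def keyA (p : QuadParam) : ℕ := p.h₁₂ * p.h₁₃ * p.h₂₄ * p.h₃₄ * p.s₂ * p.s₃ * p.s₄ * p.w

/-- The quotient `(d₃ * y₃ + d₄ * y₄) / (h₁₂ * h₃₄)`. -/
def quot (p : QuadParam) : ℕ :=
  (p.d₃ * (p.h₁₃ * p.h₂₃ * p.s₃) + p.d₄ * (p.h₁₄ * p.h₂₄ * p.s₄)) / p.h₁₂

/-- The product of `quot` with the parameters dividing both of the first two terms. -/
def keyC (p : QuadParam) : ℕ := p.quot * p.h₃₄ * p.w * p.s₃ * p.s₄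

namespace Valid

variable {p : QuadParam} {m n a₁ a₂ a₃ a₄ : ℕ}

theorem d₁_pos (h : p.Valid m n a₁ a₂ a₃ a₄) (hn : 0 < n) : 0 < p.d₁ :=
  Nat.pos_of_dvd_of_pos h.dvd₁ hn

theorem d₂_pos (h : p.Valid m n a₁ a₂ a₃ a₄) (hn : 0 < n) : 0 < p.d₂ :=
  Nat.pos_of_dvd_of_pos h.dvd₂ hn

theorem d₃_pos (h : p.Valid m n a₁ a₂ a₃ a₄) (hn : 0 < n) : 0 < p.d₃ :=
  Nat.pos_of_dvd_of_pos h.dvd₃ hn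

theorem d₄_pos (h : p.Valid m n a₁ a₂ a₃ a₄) (hn : 0 < n) : 0 < p.d₄ :=
  Nat.pos_of_dvd_of_pos h.dvd₄ hn

/-- Modulo `h₁₄` only the second and third terms of the equation survive. Their common factor `h₂₃`
is coprime to `h₁₄` and can be dropped. -/
theorem h₁₄_dvd (h : p.Valid m n a₁ a₂ a₃ a₄) :
    p.h₁₄ ∣ p.d₂ * (p.h₁₂ * p.h₂₄ * p.s₂) + p.d₃ * (p.h₁₃ * p.h₃₄ * p.s₃) := by
  refine h.coprime₂.dvd_of_dvd_mul_left (m := p.h₂₃) ?_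
  have h1 : p.h₁₄ ∣ p.h₁₄ * (p.d₁ * (p.h₁₂ * p.h₁₃ * p.s₁) + p.d₄ * (p.h₂₄ * p.h₃₄ * p.s₄)) +
      p.h₂₃ * (p.d₂ * (p.h₁₂ * p.h₂₄ * p.s₂) + p.d₃ * (p.h₁₃ * p.h₃₄ * p.s₃)) := by
    refine ⟨m * (p.w * p.h₁₂ * p.h₁₃ * p.h₂₃ * p.h₂₄ * p.h₃₄ * p.s₁ * p.s₂ * p.s₃ * p.s₄), ?_⟩
    linarith [h.eq]
  exact (Nat.dvd_add_right (Dvd.intro _ rfl)).mp h1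

theorem h₁₂_dvd (h : p.Valid m n a₁ a₂ a₃ a₄) :
    p.h₁₂ ∣ p.d₃ * (p.h₁₃ * p.h₂₃ * p.s₃) + p.d₄ * (p.h₁₄ * p.h₂₄ * p.s₄) := by
  refine h.coprime₁.dvd_of_dvd_mul_left (m := p.h₃₄) ?_
  have h1 : p.h₁₂ ∣ p.h₁₂ * (p.d₁ * (p.h₁₃ * p.h₁₄ * p.s₁) + p.d₂ * (p.h₂₃ * p.h₂₄ * p.s₂)) +
      p.h₃₄ * (p.d₃ * (p.h₁₃ * p.h₂₃ * p.s₃) + p.d₄ * (p.h₁₄ * p.h₂₄ * p.s₄)) := by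
    refine ⟨m * (p.w * p.h₁₃ * p.h₁₄ * p.h₂₃ * p.h₂₄ * p.h₃₄ * p.s₁ * p.s₂ * p.s₃ * p.s₄), ?_⟩
    linarith [h.eq]
  exact (Nat.dvd_add_right (Dvd.intro _ rfl)).mp h1

theorem h₁₂_mul_quot (h : p.Valid m n a₁ a₂ a₃ a₄) :
    p.h₁₂ * p.quot = p.d₃ * (p.h₁₃ * p.h₂₃ * p.s₃) + p.d₄ * (p.h₁₄ * p.h₂₄ * p.s₄) :=
  Nat.mul_div_cancel' h.h₁₂_dvd

theorem prod_eq (h : p.Valid m n a₁ a₂ a₃ a₄) :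
    m * p.prod =
    p.d₁ * (p.h₁₂ * p.h₁₃ * p.h₁₄ * p.s₁) + p.d₂ * (p.h₁₂ * p.h₂₃ * p.h₂₄ * p.s₂) +
    p.d₃ * (p.h₁₃ * p.h₂₃ * p.h₃₄ * p.s₃) + p.d₄ * (p.h₁₄ * p.h₂₄ * p.h₃₄ * p.s₄) := h.eq

theorem prod_pos (h : p.Valid m n a₁ a₂ a₃ a₄) : 0 < p.prod := by
  have := h.h₁₂_pos
  have := h.h₁₃_pos
  have := h.h₁₄_pos
  have := h.h₂₃_pos
  have := h.h₂₄_pos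
  have := h.h₃₄_pos
  have := h.s₁_pos
  have := h.s₂_pos
  have := h.s₃_pos
  have := h.s₄_pos
  have := h.w_pos
  unfold prod
  positivity

theorem keyA_dvd (p : QuadParam) : p.keyA ∣ p.prod :=
  ⟨p.h₁₄ * p.h₂₃ * p.s₁, by unfold keyA prod; ring⟩

theorem quot_pos (h : p.Valid m n a₁ a₂ a₃ a₄) (hn : 0 < n) : 0 < p.quot := by
  have := h.h₁₃_pos
  have := h.h₂₃_pos
  have := h.s₃_pos
  have := h.d₃_pos hn
  refine Nat.pos_of_mul_pos_left (a := p.h₁₂) ?_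
  rw [h.h₁₂_mul_quot]
  positivity

theorem h₃₄_mul_h₁₂_mul_quot_le (h : p.Valid m n a₁ a₂ a₃ a₄) :
    p.h₃₄ * (p.h₁₂ * p.quot) ≤ m * p.prod := by
  have : p.h₃₄ * (p.h₁₂ * p.quot) =
      p.d₃ * (p.h₁₃ * p.h₂₃ * p.h₃₄ * p.s₃) + p.d₄ * (p.h₁₄ * p.h₂₄ * p.h₃₄ * p.s₄) := by
    rw [h.h₁₂_mul_quot]; ring
  rw [this, h.prod_eq]
  omega

theorem keyA_pos (h : p.Valid m n a₁ a₂ a₃ a₄) : 0 < p.keyA :=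
  Nat.pos_of_dvd_of_pos (keyA_dvd p) h.prod_pos

theorem keyC_pos (h : p.Valid m n a₁ a₂ a₃ a₄) (hn : 0 < n) : 0 < p.keyC := by
  have := h.quot_pos hn
  have := h.h₃₄_pos
  have := h.s₃_pos
  have := h.s₄_pos
  have := h.w_pos
  unfold keyC
  positivity

theorem keyC_le (h : p.Valid m n a₁ a₂ a₃ a₄) (hm : 0 < m) : p.keyC ≤ (m * p.prod) ^ 2 := by
  have h1 : p.w * p.s₃ * p.s₄ ∣ p.prod :=
    ⟨p.h₁₂ * p.h₁₃ * p.h₁₄ * p.h₂₃ * p.h₂₄ * p.h₃₄ * p.s₁ * p.s₂, by unfold prod; ring⟩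
  have h2 := Nat.le_of_dvd h.prod_pos h1
  calc p.keyC = p.h₃₄ * p.quot * (p.w * p.s₃ * p.s₄) := by unfold keyC; ring
    _ ≤ p.h₃₄ * (p.h₁₂ * p.quot) * (m * p.prod) :=
        Nat.mul_le_mul (Nat.mul_le_mul_left _ (Nat.le_mul_of_pos_left _ h.h₁₂_pos))
          (h2.trans (Nat.le_mul_of_pos_left _ hm))
    _ ≤ m * p.prod * (m * p.prod) := Nat.mul_le_mul_right _ h.h₃₄_mul_h₁₂_mul_quot_le
    _ = _ := by ring

theorem dvd_a₁ (h : p.Valid m n a₁ a₂ a₃ a₄) (hn : 0 < n) :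
    p.w * p.h₂₃ * p.h₂₄ * p.h₃₄ * p.s₂ * p.s₃ * p.s₄ ∣ a₁ := by
  obtain ⟨c, hc⟩ := h.dvd₁
  refine ⟨c, Nat.eq_of_mul_eq_mul_right (h.d₁_pos hn) ?_⟩
  rw [h.eq₁]
  nth_rewrite 1 [hc]
  ring

theorem dvd_a₂ (h : p.Valid m n a₁ a₂ a₃ a₄) (hn : 0 < n) :
    p.w * p.h₁₃ * p.h₁₄ * p.h₃₄ * p.s₁ * p.s₃ * p.s₄ ∣ a₂ := by
  obtain ⟨c, hc⟩ := h.dvd₂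
  refine ⟨c, Nat.eq_of_mul_eq_mul_right (h.d₂_pos hn) ?_⟩
  rw [h.eq₂]
  nth_rewrite 1 [hc]
  ring

end Valid

end QuadParam

/-- A finite family of parametrized representations of `m / n` as a sum of four unit fractions,
with all parameters controlled by `X`; the first denominator is determined by `j`. -/
structure QuadFamily {σ : Type*} (S : Finset σ) (m n : ℕ) (a₁ a₂ a₃ a₄ j : σ → ℕ)
    (p : σ → QuadParam) (X : ℕ) : Prop where
  m_pos : 0 < m
  n_pos : 0 < n
  valid : ∀ s ∈ S, (p s).Valid m n (a₁ s) (a₂ s) (a₃ s) (a₄ s)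
  n_le : n ≤ X
  a₁_pos : ∀ s ∈ S, 0 < a₁ s
  a₁_le : ∀ s ∈ S, a₁ s ≤ X
  j_pos : ∀ s ∈ S, 0 < j s
  j_mul_le : ∀ s ∈ S, j s * (p s).prod ≤ X
  sq_le : ∀ s ∈ S, (m * (p s).prod) ^ 2 ≤ X
  a₁_eq : ∀ s ∈ S, ∀ t ∈ S, j s = j t → a₁ s = a₁ t
  inj : ∀ s ∈ S, ∀ t ∈ S, a₁ s = a₁ t → a₂ s = a₂ t → a₃ s = a₃ t → a₄ s = a₄ t → s = t

namespace QuadFamily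

variable {σ α : Type*} {S : Finset σ} {m n : ℕ} {a₁ a₂ a₃ a₄ j : σ → ℕ} {p : σ → QuadParam} {X : ℕ}
  {F : σ → α} {K : ℕ}

theorem le_X (h : QuadFamily S m n a₁ a₂ a₃ a₄ j p X) {s : σ} (hs : s ∈ S) {k : ℕ}
    (hk : k ≤ m * (p s).prod) : k ≤ X :=
  (hk.trans (Nat.le_self_pow two_ne_zero _)).trans (h.sq_le s hs)

theorem le_X_of_dvd (h : QuadFamily S m n a₁ a₂ a₃ a₄ j p X) {s : σ} (hs : s ∈ S) {k : ℕ}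
    (hk : k ∣ (p s).prod) : 0 < k ∧ k ≤ X :=
  ⟨Nat.pos_of_dvd_of_pos hk (h.valid s hs).prod_pos, h.le_X hs
    ((Nat.le_of_dvd (h.valid s hs).prod_pos hk).trans (Nat.le_mul_of_pos_left _ h.m_pos))⟩

theorem fiberBound_one (h : QuadFamily S m n a₁ a₂ a₃ a₄ j p X)
    (hF : ∀ s ∈ S, ∀ t ∈ S, F s = F t → p s = p t) : FiberBound S F 1 := by
  refine _root_.fiberBound_one fun s hs t ht hst => ?_
  have vs := h.valid s hs
  have vt := h.valid t ht
  rw [hF s hs t ht hst] at vs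
  refine h.inj s hs t ht ?_ ?_ ?_ ?_
  · exact Nat.eq_of_mul_eq_mul_right (vt.d₁_pos h.n_pos) (vs.eq₁.trans vt.eq₁.symm)
  · exact Nat.eq_of_mul_eq_mul_right (vt.d₂_pos h.n_pos) (vs.eq₂.trans vt.eq₂.symm)
  · exact Nat.eq_of_mul_eq_mul_right (vt.d₃_pos h.n_pos) (vs.eq₃.trans vt.eq₃.symm)
  · exact Nat.eq_of_mul_eq_mul_right (vt.d₄_pos h.n_pos) (vs.eq₄.trans vt.eq₄.symm)

theorem of_d (h : QuadFamily S m n a₁ a₂ a₃ a₄ j p X)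
    (hK : FiberBound S
      (fun s => (F s, [(p s).d₁, (p s).d₂, (p s).d₃, (p s).d₄])) K) :
    FiberBound S F (maxDivisors X ^ 4 * K) := by
  refine .of_dvd_list (fun _ => n) (fun s hs => ⟨h.n_pos, h.n_le⟩)
    [fun s => (p s).d₁, fun s => (p s).d₂, fun s => (p s).d₃, fun s => (p s).d₄]
    (fun _ _ _ _ _ => rfl) ?_ hK
  simp only [List.forall_mem_cons, List.not_mem_nil, false_imp_iff, implies_true, and_true]
  exact ⟨fun s hs => (h.valid s hs).dvd₁, fun s hs => (h.valid s hs).dvd₂,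
    fun s hs => (h.valid s hs).dvd₃, fun s hs => (h.valid s hs).dvd₄⟩

/-- The exponent is 8 + 4 + 1 + 1: the factors of `keyA`, the `d i`, then `h₁₄` as a divisor of the
known number `R`, and finally `s₁` and `h₂₃` from the equation divided by `h₁₄`, which is bilinear
in them. -/
theorem fiberBound_keyA (h : QuadFamily S m n a₁ a₂ a₃ a₄ j p X) :
    FiberBound S (fun s => (p s).keyA) (maxDivisors X ^ 14) := by
  rw [show maxDivisors X ^ 14 = maxDivisors X ^ 8 * (maxDivisors X ^ 4 *
    (maxDivisors X * (maxDivisors X * 1))) by ring]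
  refine .of_dvd_list (fun s => (p s).keyA)
    (fun s hs => h.le_X_of_dvd hs (QuadParam.Valid.keyA_dvd _))
    [fun s => (p s).h₁₂, fun s => (p s).h₁₃, fun s => (p s).h₂₄, fun s => (p s).h₃₄,
      fun s => (p s).s₂, fun s => (p s).s₃, fun s => (p s).s₄, fun s => (p s).w]
    (fun s hs t ht hst => hst) ?_ ?_
  · simp only [List.forall_mem_cons, List.not_mem_nil, false_imp_iff, implies_true, and_true]
    refine ⟨?_, ?_, ?_, ?_, ?_, ?_, ?_, ?_⟩ <;> intro s _ <;> unfold QuadParam.keyA <;>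
    repeat first | exact dvd_rfl | exact dvd_mul_left _ _ | apply Dvd.dvd.mul_right
  simp only [List.map_cons, List.map_nil]
  refine h.of_d ?_
  set R : σ → ℕ := fun s => (p s).d₂ * ((p s).h₁₂ * (p s).h₂₄ * (p s).s₂) +
    (p s).d₃ * ((p s).h₁₃ * (p s).h₃₄ * (p s).s₃) with hRdef
  have hR0 : ∀ s ∈ S, 0 < R s := fun s hs => by
    have v := h.valid s hs
    have := v.h₁₂_pos
    have := v.h₂₄_pos
    have := v.s₂_pos
    have := v.d₂_pos h.n_pos
    simp only [hRdef]
    positivity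
  refine .of_dvd (fun s => (p s).h₁₄) R
    (fun s hs => ⟨(h.valid s hs).h₁₄_dvd, hR0 s hs, h.le_X hs ?_⟩) (fun s hs t ht hst => ?_) ?_
  · refine (Nat.le_mul_of_pos_left _ (h.valid s hs).h₂₃_pos).trans ?_
    have : (p s).h₂₃ * R s = (p s).d₂ * ((p s).h₁₂ * (p s).h₂₃ * (p s).h₂₄ * (p s).s₂) +
      (p s).d₃ * ((p s).h₁₃ * (p s).h₂₃ * (p s).h₃₄ * (p s).s₃) := by simp only [hRdef]; ring
    rw [this, (h.valid s hs).prod_eq]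
    omega
  · simp only [Prod.mk.injEq, List.cons.injEq] at hst
    simp only [hRdef, hst]
  have hquot : ∀ s ∈ S, (p s).h₁₄ * (R s / (p s).h₁₄) = R s := fun s hs =>
    Nat.mul_div_cancel' (h.valid s hs).h₁₄_dvd
  have heq : ∀ s ∈ S, m * ((p s).w * (p s).h₁₂ * (p s).h₁₃ * (p s).h₂₄ * (p s).h₃₄ * (p s).s₂ *
      (p s).s₃ * (p s).s₄) * (p s).s₁ * (p s).h₂₃ =
      (p s).d₁ * ((p s).h₁₂ * (p s).h₁₃) * (p s).s₁ + R s / (p s).h₁₄ * (p s).h₂₃ +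
        (p s).d₄ * ((p s).h₂₄ * (p s).h₃₄ * (p s).s₄) := fun s hs => by
    have v := h.valid s hs
    refine Nat.eq_of_mul_eq_mul_left v.h₁₄_pos ?_
    calc _ = m * (p s).prod := by unfold QuadParam.prod; ring
      _ = (p s).h₁₄ * ((p s).d₁ * ((p s).h₁₂ * (p s).h₁₃) * (p s).s₁) + R s * (p s).h₂₃ +
          (p s).h₁₄ * ((p s).d₄ * ((p s).h₂₄ * (p s).h₃₄ * (p s).s₄)) := by
          rw [v.prod_eq]; simp only [hRdef]; ring
      _ = _ := by nth_rewrite 1 [← hquot s hs]; ring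
  refine .of_bilinear (fun s => (p s).s₁) (fun s => (p s).h₂₃)
    (fun s => m * ((p s).w * (p s).h₁₂ * (p s).h₁₃ * (p s).h₂₄ * (p s).h₃₄ * (p s).s₂ *
      (p s).s₃ * (p s).s₄))
    (fun s => (p s).d₁ * ((p s).h₁₂ * (p s).h₁₃)) (fun s => R s / (p s).h₁₄)
    (fun s => (p s).d₄ * ((p s).h₂₄ * (p s).h₃₄ * (p s).s₄))
    (fun s hs => ?_) heq (fun s hs => ?_) (fun s hs t ht hst => ?_) ?_
  · have v := h.valid s hs
    have := v.h₁₂_pos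
    have := v.h₁₃_pos
    have := v.d₁_pos h.n_pos
    refine ⟨by positivity, ?_, v.s₁_pos⟩
    exact Nat.div_pos (Nat.le_of_dvd (hR0 s hs) v.h₁₄_dvd) v.h₁₄_pos
  · refine le_trans (Nat.pow_le_pow_left ?_ 2) (h.sq_le s hs)
    rw [mul_assoc, mul_assoc]
    refine Nat.mul_le_mul_left _ (Nat.le_of_dvd (h.valid s hs).prod_pos ⟨(p s).h₁₄, ?_⟩)
    unfold QuadParam.prod
    ring
  · simp only [Prod.mk.injEq, List.cons.injEq] at hst
    simp only [hRdef, hst, and_self]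
  · refine h.fiberBound_one fun s hs t ht hst => ?_
    simp only [Prod.mk.injEq, List.cons.injEq] at hst
    cases hs' : p s
    cases ht' : p t
    simp_all

/-- The exponent is 3 + 7 + 4 + 1. The key yields `j`, hence `a₁`, whose divisors include the seven
parameters of `t₁`. After the `d i`, the equation is bilinear in the remaining `h₁₂` and `h₁₃`. -/
theorem fiberBound_keyB (h : QuadFamily S m n a₁ a₂ a₃ a₄ j p X) :
    FiberBound S (fun s => j s * (p s).h₁₄ * (p s).s₁) (maxDivisors X ^ 15) := by
  rw [show maxDivisors X ^ 15 = maxDivisors X ^ 3 * (maxDivisors X ^ 7 * (maxDivisors X ^ 4 *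
    (maxDivisors X * 1))) by ring]
  refine .of_dvd_list (fun s => j s * (p s).h₁₄ * (p s).s₁) (fun s hs => ⟨?_, ?_⟩)
    [j, fun s => (p s).h₁₄, fun s => (p s).s₁] (fun s hs t ht hst => hst) ?_ ?_
  · exact Nat.mul_pos (Nat.mul_pos (h.j_pos s hs) (h.valid s hs).h₁₄_pos) (h.valid s hs).s₁_pos
  · refine le_trans ?_ (h.j_mul_le s hs)
    rw [mul_assoc]
    refine Nat.mul_le_mul_left _ (Nat.le_of_dvd (h.valid s hs).prod_pos
      ⟨(p s).w * (p s).h₁₂ * (p s).h₁₃ * (p s).h₂₃ * (p s).h₂₄ * (p s).h₃₄ * (p s).s₂ * (p s).s₃ *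
        (p s).s₄, ?_⟩)
    unfold QuadParam.prod
    ring
  · simp only [List.forall_mem_cons, List.not_mem_nil, false_imp_iff, implies_true, and_true]
    refine ⟨?_, ?_, ?_⟩ <;> intro s _ <;>
    repeat first | exact dvd_rfl | exact dvd_mul_left _ _ | apply Dvd.dvd.mul_right
  simp only [List.map_cons, List.map_nil]
  refine .of_dvd_list a₁ (fun s hs => ⟨h.a₁_pos s hs, h.a₁_le s hs⟩)
    [fun s => (p s).w, fun s => (p s).h₂₃, fun s => (p s).h₂₄, fun s => (p s).h₃₄,
      fun s => (p s).s₂, fun s => (p s).s₃, fun s => (p s).s₄]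
    (fun s hs t ht hst => ?_) ?_ ?_
  · simp only [Prod.mk.injEq, List.cons.injEq] at hst
    exact h.a₁_eq s hs t ht hst.2.1
  · simp only [List.forall_mem_cons, List.not_mem_nil, false_imp_iff, implies_true, and_true]
    refine ⟨?_, ?_, ?_, ?_, ?_, ?_, ?_⟩ <;> intro s hs <;>
    refine dvd_trans ?_ ((h.valid s hs).dvd_a₁ h.n_pos) <;>
    repeat first | exact dvd_rfl | exact dvd_mul_left _ _ | apply Dvd.dvd.mul_right
  simp only [List.map_cons, List.map_nil]
  refine h.of_d ?_
  have heq : ∀ s ∈ S, (m * ((p s).w * (p s).h₂₃ * (p s).h₂₄ * (p s).h₃₄ * (p s).s₂ *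
      (p s).s₃ * (p s).s₄) * ((p s).h₁₄ * (p s).s₁) - (p s).d₁ * ((p s).h₁₄ * (p s).s₁)) *
        (p s).h₁₂ * (p s).h₁₃ =
      (p s).d₂ * ((p s).h₂₃ * (p s).h₂₄ * (p s).s₂) * (p s).h₁₂ +
        (p s).d₃ * ((p s).h₂₃ * (p s).h₃₄ * (p s).s₃) * (p s).h₁₃ +
        (p s).d₄ * ((p s).h₁₄ * (p s).h₂₄ * (p s).h₃₄ * (p s).s₄) := fun s hs => by
    -- The first term of the equation is moved to the left, into the leading coefficient.
    rw [Nat.sub_mul, Nat.sub_mul]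
    refine Nat.sub_eq_of_eq_add ?_
    calc _ = m * (p s).prod := by unfold QuadParam.prod; ring
      _ = _ := by rw [(h.valid s hs).prod_eq]; ring
  refine .of_bilinear (fun s => (p s).h₁₂) (fun s => (p s).h₁₃)
    (fun s => m * ((p s).w * (p s).h₂₃ * (p s).h₂₄ * (p s).h₃₄ * (p s).s₂ *
      (p s).s₃ * (p s).s₄) * ((p s).h₁₄ * (p s).s₁) - (p s).d₁ * ((p s).h₁₄ * (p s).s₁))
    (fun s => (p s).d₂ * ((p s).h₂₃ * (p s).h₂₄ * (p s).s₂))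
    (fun s => (p s).d₃ * ((p s).h₂₃ * (p s).h₃₄ * (p s).s₃))
    (fun s => (p s).d₄ * ((p s).h₁₄ * (p s).h₂₄ * (p s).h₃₄ * (p s).s₄))
    (fun s hs => ?_) heq (fun s hs => ?_) (fun s hs t ht hst => ?_) ?_
  · have v := h.valid s hs
    have := v.h₂₃_pos
    have := v.h₂₄_pos
    have := v.h₃₄_pos
    have := v.s₂_pos
    have := v.s₃_pos
    have := v.d₂_pos h.n_pos
    have := v.d₃_pos h.n_pos
    exact ⟨by positivity, by positivity, v.h₁₂_pos⟩
  · refine le_trans (Nat.pow_le_pow_left ?_ 2) (h.sq_le s hs)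
    rw [mul_assoc]
    refine (Nat.mul_le_mul_right _ (Nat.sub_le _ _)).trans (le_of_eq ?_)
    unfold QuadParam.prod
    ring
  · simp only [Prod.mk.injEq, List.cons.injEq] at hst
    simp only [hst, and_self]
  · refine h.fiberBound_one fun s hs t ht hst => ?_
    simp only [Prod.mk.injEq, List.cons.injEq] at hst
    cases hs' : p s
    cases ht' : p t
    simp_all

/-- The exponent is 5 + 4 + 1 + 3 + 3 + 1. After the factors of `keyC` and the `d i`, the equation
divided by `h₁₂` is bilinear in `x = h₂₃ h₂₄ s₂` and `y = h₁₃ h₁₄ s₁`. These are then split into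
their factors, and `h₁₂` divides a known sum. -/
theorem fiberBound_keyC (h : QuadFamily S m n a₁ a₂ a₃ a₄ j p X) :
    FiberBound S (fun s => (p s).keyC) (maxDivisors X ^ 17) := by
  rw [show maxDivisors X ^ 17 = maxDivisors X ^ 5 * (maxDivisors X ^ 4 * (maxDivisors X *
    (maxDivisors X ^ 3 * (maxDivisors X ^ 3 * (maxDivisors X * 1))))) by ring]
  refine .of_dvd_list (fun s => (p s).keyC)
    (fun s hs => ⟨(h.valid s hs).keyC_pos h.n_pos,
      ((h.valid s hs).keyC_le h.m_pos).trans (h.sq_le s hs)⟩)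
    [fun s => (p s).quot, fun s => (p s).h₃₄, fun s => (p s).w, fun s => (p s).s₃,
      fun s => (p s).s₄] (fun s hs t ht hst => hst) ?_ ?_
  · simp only [List.forall_mem_cons, List.not_mem_nil, false_imp_iff, implies_true, and_true]
    refine ⟨?_, ?_, ?_, ?_, ?_⟩ <;> intro s _ <;> unfold QuadParam.keyC <;>
    repeat first | exact dvd_rfl | exact dvd_mul_left _ _ | apply Dvd.dvd.mul_right
  simp only [List.map_cons, List.map_nil]
  refine h.of_d ?_
  set x : σ → ℕ := fun s => (p s).h₂₃ * (p s).h₂₄ * (p s).s₂ with hx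
  set y : σ → ℕ := fun s => (p s).h₁₃ * (p s).h₁₄ * (p s).s₁ with hy
  have heq : ∀ s ∈ S, m * ((p s).w * (p s).h₃₄ * (p s).s₃ * (p s).s₄) * x s * y s =
      (p s).d₂ * x s + (p s).d₁ * y s + (p s).h₃₄ * (p s).quot := fun s hs => by
    have v := h.valid s hs
    refine Nat.eq_of_mul_eq_mul_left v.h₁₂_pos ?_
    calc _ = m * (p s).prod := by simp only [hx, hy]; unfold QuadParam.prod; ring
      _ = (p s).h₁₂ * ((p s).d₂ * x s + (p s).d₁ * y s) + (p s).h₃₄ * ((p s).h₁₂ * (p s).quot) := by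
          rw [v.prod_eq, v.h₁₂_mul_quot]; simp only [hx, hy]; ring
      _ = _ := by ring
  refine .of_bilinear x y
    (fun s => m * ((p s).w * (p s).h₃₄ * (p s).s₃ * (p s).s₄)) (fun s => (p s).d₂)
    (fun s => (p s).d₁) (fun s => (p s).h₃₄ * (p s).quot)
    (fun s hs => ?_) heq (fun s hs => ?_) (fun s hs t ht hst => ?_) ?_
  · have v := h.valid s hs
    have := v.h₂₃_pos
    have := v.h₂₄_pos
    have := v.s₂_pos
    refine ⟨v.d₂_pos h.n_pos, v.d₁_pos h.n_pos, ?_⟩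
    simp only [hx]
    positivity
  · refine le_trans (Nat.pow_le_pow_left ?_ 2) (h.sq_le s hs)
    rw [mul_assoc, mul_assoc]
    refine Nat.mul_le_mul_left _ (Nat.le_of_dvd (h.valid s hs).prod_pos ⟨(p s).h₁₂, ?_⟩)
    unfold QuadParam.prod
    ring
  · simp only [Prod.mk.injEq, List.cons.injEq] at hst
    simp only [hst, and_self]
  refine .of_dvd_list x (fun s hs => h.le_X_of_dvd hs ⟨(p s).w * (p s).h₁₂ * (p s).h₁₃ *
      (p s).h₁₄ * (p s).h₃₄ * (p s).s₁ * (p s).s₃ * (p s).s₄, ?_⟩)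
    [fun s => (p s).h₂₃, fun s => (p s).h₂₄, fun s => (p s).s₂] (fun s hs t ht hst => ?_) ?_ ?_
  · simp only [hx]
    unfold QuadParam.prod
    ring
  · simp only [Prod.mk.injEq] at hst
    exact hst.1.2
  · simp only [List.forall_mem_cons, List.not_mem_nil, false_imp_iff, implies_true, and_true]
    refine ⟨?_, ?_, ?_⟩ <;> intro s _ <;>
    repeat first | exact dvd_rfl | exact dvd_mul_left _ _ | apply Dvd.dvd.mul_right
  refine .of_dvd_list y (fun s hs => h.le_X_of_dvd hs ⟨(p s).w * (p s).h₁₂ * (p s).h₂₃ *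
      (p s).h₂₄ * (p s).h₃₄ * (p s).s₂ * (p s).s₃ * (p s).s₄, ?_⟩)
    [fun s => (p s).h₁₃, fun s => (p s).h₁₄, fun s => (p s).s₁] (fun s hs t ht hst => ?_) ?_ ?_
  · simp only [hy]
    unfold QuadParam.prod
    ring
  · simp only [Prod.mk.injEq] at hst
    exact hst.1.2
  · simp only [List.forall_mem_cons, List.not_mem_nil, false_imp_iff, implies_true, and_true]
    refine ⟨?_, ?_, ?_⟩ <;> intro s _ <;>
    repeat first | exact dvd_rfl | exact dvd_mul_left _ _ | apply Dvd.dvd.mul_right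
  simp only [List.map_cons, List.map_nil]
  refine .of_dvd (fun s => (p s).h₁₂) (fun s => (p s).d₃ * ((p s).h₁₃ * (p s).h₂₃ * (p s).s₃) +
      (p s).d₄ * ((p s).h₁₄ * (p s).h₂₄ * (p s).s₄))
    (fun s hs => ⟨(h.valid s hs).h₁₂_dvd, ?_⟩) (fun s hs t ht hst => ?_) ?_
  · have v := h.valid s hs
    rw [← v.h₁₂_mul_quot]
    exact ⟨Nat.mul_pos v.h₁₂_pos (v.quot_pos h.n_pos),
      h.le_X hs ((Nat.le_mul_of_pos_left _ v.h₃₄_pos).trans v.h₃₄_mul_h₁₂_mul_quot_le)⟩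
  · simp only [Prod.mk.injEq, List.cons.injEq] at hst
    simp only [hst]
  · refine h.fiberBound_one fun s hs t ht hst => ?_
    simp only [Prod.mk.injEq, List.cons.injEq] at hst
    cases hs' : p s
    cases ht' : p t
    simp_all

end QuadFamily

/-! ### Representations as a sum of four unit fractions -/

/-- Subtracting the unit fractions one by one leaves positive remainders with integer numerators
`u`, `v`, `r`. Each remainder is at most the number of terms left times the largest of them. -/
theorem unitFractionReps_four_bounds {m n : ℕ} (hn : 0 < n) {a : Fin 4 → ℕ}
    (ha : a ∈ unitFractionReps 4 m n) :
    n < m * a 0 ∧ m * a 0 ≤ 4 * n ∧ (m * a 0 - n) * a 1 ≤ 3 * n * a 0 ∧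
      a 2 ≤ 2 * n * a 0 * a 1 ∧ a 3 ≤ n * a 0 * a 1 * a 2 := by
  obtain ⟨hpos, hmono, heq⟩ := ha
  have p0 := hpos 0
  have p1 := hpos 1
  have p2 := hpos 2
  have p3 := hpos 3
  have m1 : a 0 ≤ a 1 := hmono (by decide)
  have m2 : a 1 ≤ a 2 := hmono (by decide)
  have m3 : a 2 ≤ a 3 := hmono (by decide)
  rw [Fin.sum_univ_four] at heq
  generalize a 0 = x at *
  generalize a 1 = y at *
  generalize a 2 = z at *
  generalize a 3 = t at *
  have key : m * x * (y * z * t) = n * (y * z * t + x * z * t + x * y * t + x * y * z) := by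
    have h0 : (n : ℚ) ≠ 0 := by exact_mod_cast hn.ne'
    have h1 : (x : ℚ) ≠ 0 := by exact_mod_cast p0.ne'
    have h2 : (y : ℚ) ≠ 0 := by exact_mod_cast p1.ne'
    have h3 : (z : ℚ) ≠ 0 := by exact_mod_cast p2.ne'
    have h4 : (t : ℚ) ≠ 0 := by exact_mod_cast p3.ne'
    have : (m : ℚ) * x * (y * z * t) =
        n * (y * z * t + x * z * t + x * y * t + x * y * z) := by
      field_simp at heq
      linarith
    exact_mod_cast this
  have q1 : 0 < y * z * t := by positivity
  have i1 : n < m * x := by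
    by_contra hcon
    have h1 := Nat.mul_le_mul_right (y * z * t) (not_lt.mp hcon)
    have h2 : 0 < n * (x * z * t) := by positivity
    linarith [h1, key, h2, Nat.zero_le (n * (x * y * t)), Nat.zero_le (n * (x * y * z))]
  have b1 : x * z * t ≤ y * z * t := by gcongr
  have b2 : x * y * t ≤ x * z * t := by gcongr
  have b3 : x * y * z ≤ x * y * t := by gcongr
  have i2 : m * x ≤ 4 * n := by
    refine Nat.le_of_mul_le_mul_right ?_ q1
    calc m * x * (y * z * t) = n * (y * z * t + x * z * t + x * y * t + x * y * z) := key
      _ ≤ n * (4 * (y * z * t)) := Nat.mul_le_mul_left _ (by omega)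
      _ = _ := by ring
  obtain ⟨u, hu, hu0⟩ : ∃ u, m * x = n + u ∧ 0 < u := ⟨m * x - n, by omega, by omega⟩
  have key2 : u * y * (z * t) = n * x * (z * t + y * t + y * z) := by
    rw [hu] at key
    linarith
  have i3 : u * y ≤ 3 * n * x := by
    refine Nat.le_of_mul_le_mul_right (c := z * t) ?_ (by positivity)
    rw [key2]
    have : z * t + y * t + y * z ≤ 3 * (z * t) := by
      have : y * t ≤ z * t := by gcongr
      have : y * z ≤ z * t := by rw [mul_comm z t]; gcongr; omega
      omega
    calc _ ≤ n * x * (3 * (z * t)) := Nat.mul_le_mul_left _ this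
      _ = _ := by ring
  have i4 : n * x < u * y := by
    by_contra hcon
    have h1 := Nat.mul_le_mul_right (z * t) (not_lt.mp hcon)
    have h2 : 0 < n * x * (y * t) := by positivity
    linarith [h1, key2, h2, Nat.zero_le (n * x * (y * z))]
  obtain ⟨v, hv, hv0⟩ : ∃ v, u * y = n * x + v ∧ 0 < v := ⟨u * y - n * x, by omega, by omega⟩
  have key3 : v * z * t = n * x * y * (t + z) := by
    rw [hv] at key2
    linarith
  have i5 : v * z ≤ 2 * n * x * y := by
    refine Nat.le_of_mul_le_mul_right (c := t) ?_ p3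
    rw [key3]
    calc _ ≤ n * x * y * (2 * t) := Nat.mul_le_mul_left _ (by omega)
      _ = _ := by ring
  have i6 : n * x * y < v * z := by
    by_contra hcon
    have h1 := Nat.mul_le_mul_right t (not_lt.mp hcon)
    have h2 : 0 < n * x * y * z := by positivity
    linarith [h1, key3, h2]
  obtain ⟨r, hr, hr0⟩ : ∃ r, v * z = n * x * y + r ∧ 0 < r := ⟨v * z - n * x * y, by omega, by omega⟩
  have key4 : r * t = n * x * y * z := by
    rw [hr] at key3
    linarith
  refine ⟨i1, i2, ?_, (Nat.le_mul_of_pos_left _ hv0).trans i5, ?_⟩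
  · rw [hu, Nat.add_sub_cancel_left]
    exact i3
  · exact key4 ▸ Nat.le_mul_of_pos_left _ hr0

theorem unitFractionReps_four_le {m n : ℕ} (hm : 0 < m) (hn : 0 < n) {a : Fin 4 → ℕ}
    (ha : a ∈ unitFractionReps 4 m n) :
    a 0 ≤ 4 * n ∧ a 1 ≤ 12 * n ^ 2 ∧ a 2 ≤ 96 * n ^ 4 ∧ a 3 ≤ 4608 * n ^ 8 := by
  obtain ⟨h1, h2, h3, h4, h5⟩ := unitFractionReps_four_bounds hn ha
  have e0 : a 0 ≤ 4 * n := (Nat.le_mul_of_pos_left _ hm).trans h2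
  have e1 : a 1 ≤ 12 * n ^ 2 := by
    calc a 1 ≤ (m * a 0 - n) * a 1 := Nat.le_mul_of_pos_left _ (by omega)
      _ ≤ 3 * n * a 0 := h3
      _ ≤ 3 * n * (4 * n) := by gcongr
      _ = _ := by ring
  have e2 : a 2 ≤ 96 * n ^ 4 := by
    calc a 2 ≤ 2 * n * a 0 * a 1 := h4
      _ ≤ 2 * n * (4 * n) * (12 * n ^ 2) := by gcongr
      _ = _ := by ring
  refine ⟨e0, e1, e2, ?_⟩
  calc a 3 ≤ n * a 0 * a 1 * a 2 := h5
    _ ≤ n * (4 * n) * (12 * n ^ 2) * (96 * n ^ 4) := by gcongr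
    _ = _ := by ring

theorem unitFractionReps_four_finite {m n : ℕ} (hm : 0 < m) (hn : 0 < n) :
    (unitFractionReps 4 m n).Finite := by
  refine (Set.finite_Iic (fun _ : Fin 4 => 4608 * n ^ 8)).subset fun a ha i => ?_
  exact (ha.2.1 (Fin.le_last i)).trans (unitFractionReps_four_le hm hn ha).2.2.2

/-- The index of the first denominator among the integers exceeding `n / m`. -/
def firstIndex (m n : ℕ) (a : Fin 4 → ℕ) : ℕ := a 0 - n / m - 1

theorem firstIndex_add {m n : ℕ} (hm : 0 < m) (hn : 0 < n) {a : Fin 4 → ℕ}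
    (ha : a ∈ unitFractionReps 4 m n) : a 0 = firstIndex m n a + (n / m + 1) := by
  have h1 := (unitFractionReps_four_bounds hn ha).1
  have h2 : n / m < a 0 := (Nat.div_lt_iff_lt_mul hm).mpr (by linarith)
  unfold firstIndex
  omega

/-- Since `m (⌊n / m⌋ + 1)` already exceeds `n`, each further step of the first denominator adds `m`
to the numerator `m a - n`. A large index therefore forces a small second denominator. -/
theorem mul_firstIndex_le {m n : ℕ} (hm : 0 < m) (hn : 0 < n) {a : Fin 4 → ℕ}
    (ha : a ∈ unitFractionReps 4 m n) : m * firstIndex m n a ≤ m * a 0 - n := by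
  have h1 : m * a 0 = m * firstIndex m n a + m * (n / m + 1) := by
    rw [← mul_add, ← firstIndex_add hm hn ha]
  have h2 : n < m * (n / m + 1) :=
    Nat.lt_mul_div_succ n hm
  omega

/-- A polynomial bound for all numbers whose divisors are counted. -/
def polyBound (n : ℕ) : ℕ := 10 ^ 18 * n ^ 32

theorem polyBound_pos {n : ℕ} (hn : 0 < n) : 0 < polyBound n :=
  Nat.mul_pos (by norm_num) (pow_pos hn _)

theorem le_polyBound {n c k : ℕ} (hn : 0 < n) (hc : c ≤ 10 ^ 18) (hk : k ≤ 32) :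
    c * n ^ k ≤ polyBound n :=
  Nat.mul_le_mul hc (Nat.pow_le_pow_right hn hk)

theorem sq_le_polyBound {m n L : ℕ} (hn : 0 < n) (hm : m ≤ 4 * n)
    (hL : L ≤ 10 ^ 8 * n ^ 15) : (m * L) ^ 2 ≤ polyBound n := by
  calc (m * L) ^ 2 ≤ (4 * n * (10 ^ 8 * n ^ 15)) ^ 2 := by gcongr
    _ = (4 * 10 ^ 8) ^ 2 * n ^ 32 := by ring
    _ ≤ _ := le_polyBound hn (by norm_num) le_rfl

/-! ### Parametrized families of representations -/

section Families

variable {m n : ℕ} {S : Finset (Fin 4 → ℕ)}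

/-- The three-term parametrization is applied to `m / n - 1 / a 0 = (m * a 0 - n) / (n * a 0)`. -/
theorem exists_tripleFamily (hm : 0 < m) (hn : 0 < n) (hS : ∀ a ∈ S, a ∈ unitFractionReps 4 m n) :
    ∃ p, TripleFamily S (fun a => m * a 0 - n) (fun a => n * a 0) (fun a => a 1) (fun a => a 2)
      (fun a => a 3) p (polyBound n) := by
  have hex : ∀ a, a ∈ S → ∃ p : TripleParam, p.Valid (m * a 0 - n) (n * a 0) (a 1) (a 2) (a 3) := by
    intro a ha
    obtain ⟨hpos, -, heq⟩ := hS a ha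
    have h1 := (unitFractionReps_four_bounds hn (hS a ha)).1
    refine TripleParam.exists_valid (Nat.mul_pos hn (hpos 0)) (hpos 1) (hpos 2) (hpos 3) ?_
    rw [Fin.sum_univ_four] at heq
    have h0 : (n : ℚ) ≠ 0 := by exact_mod_cast hn.ne'
    have h2 : (a 0 : ℚ) ≠ 0 := by exact_mod_cast (hpos 0).ne'
    have h3 : ((m * a 0 - n : ℕ) : ℚ) / ((n * a 0 : ℕ) : ℚ) = (m : ℚ) / n - 1 / a 0 := by
      rw [Nat.cast_sub h1.le]
      push_cast
      field_simp
    rw [h3, heq]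
    ring
  have : Nonempty TripleParam := ⟨⟨0, 0, 0, 0, 0, 0, 0⟩⟩
  choose! p hp using hex
  refine ⟨p, hp, ?_, ?_, ?_, ?_, ?_⟩
  · intro a ha
    have := (unitFractionReps_four_bounds hn (hS a ha)).1
    omega
  · exact fun a ha => Nat.mul_pos hn ((hS a ha).1 0)
  · intro a ha
    calc n * a 0 ≤ n * (4 * n) := by
          gcongr
          exact (unitFractionReps_four_le hm hn (hS a ha)).1
      _ = 4 * n ^ 2 := by ring
      _ ≤ _ := le_polyBound hn (by norm_num) (by norm_num)
  · intro a ha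
    have h2 := (unitFractionReps_four_bounds hn (hS a ha)).2.1
    obtain ⟨e0, e1, e2, e3⟩ := unitFractionReps_four_le hm hn (hS a ha)
    have hpos := (hS a ha).1
    refine sq_le_polyBound hn (by omega) ?_
    calc _ ≤ a 1 * a 2 * a 3 := Nat.le_of_dvd
          (Nat.mul_pos (Nat.mul_pos (hpos 1) (hpos 2)) (hpos 3)) (hp a ha).dvd_prod
      _ ≤ 12 * n ^ 2 * (96 * n ^ 4) * (4608 * n ^ 8) := by gcongr
      _ = 5308416 * n ^ 14 := by ring
      _ ≤ 10 ^ 8 * n ^ 15 := Nat.mul_le_mul (by norm_num) (Nat.pow_le_pow_right hn (by norm_num))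
  · intro a ha b hb _ h0 h1 h2 h3
    funext i
    fin_cases i
    · exact Nat.eq_of_mul_eq_mul_left hn h0
    · exact h1
    · exact h2
    · exact h3

theorem exists_quadFamily (hm : 0 < m) (hn : 0 < n) (hS : ∀ a ∈ S, a ∈ unitFractionReps 4 m n)
    (hj : ∀ a ∈ S, 0 < firstIndex m n a) :
    ∃ p, QuadFamily S m n (fun a => a 0) (fun a => a 1) (fun a => a 2) (fun a => a 3)
      (firstIndex m n) p (polyBound n) := by
  have hex : ∀ a, a ∈ S → ∃ p : QuadParam, p.Valid m n (a 0) (a 1) (a 2) (a 3) := by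
    intro a ha
    obtain ⟨hpos, -, heq⟩ := hS a ha
    exact QuadParam.exists_valid hn (hpos 0) (hpos 1) (hpos 2) (hpos 3)
      (by rw [heq, Fin.sum_univ_four])
  have : Nonempty QuadParam := ⟨⟨0, 0, 0, 0, 0, 0, 0, 0, 0, 0, 0, 0, 0, 0, 0⟩⟩
  choose! p hp using hex
  have hprod : ∀ a ∈ S, (p a).prod ≤ 10 ^ 8 * n ^ 15 := fun a ha => by
    obtain ⟨e0, e1, e2, e3⟩ := unitFractionReps_four_le hm hn (hS a ha)
    have hpos := (hS a ha).1
    calc _ ≤ a 0 * a 1 * a 2 * a 3 := Nat.le_of_dvd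
          (Nat.mul_pos (Nat.mul_pos (Nat.mul_pos (hpos 0) (hpos 1)) (hpos 2)) (hpos 3))
          (hp a ha).dvd_prod
      _ ≤ 4 * n * (12 * n ^ 2) * (96 * n ^ 4) * (4608 * n ^ 8) := by gcongr
      _ = 21233664 * n ^ 15 := by ring
      _ ≤ 10 ^ 8 * n ^ 15 := Nat.mul_le_mul (by norm_num) le_rfl
  have hle0 : ∀ a ∈ S, a 0 ≤ 4 * n := fun a ha => (unitFractionReps_four_le hm hn (hS a ha)).1
  refine ⟨p, hm, hn, hp, ?_, fun a ha => (hS a ha).1 0, ?_, hj, ?_, ?_, ?_, ?_⟩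
  · simpa using le_polyBound (c := 1) (k := 1) hn (by norm_num) (by norm_num)
  · intro a ha
    have h4 := le_polyBound (c := 4) (k := 1) hn (by norm_num) (by norm_num)
    rw [pow_one] at h4
    exact (hle0 a ha).trans h4
  · intro a ha
    calc firstIndex m n a * (p a).prod ≤ 4 * n * (10 ^ 8 * n ^ 15) := by
          refine Nat.mul_le_mul (le_trans ?_ (hle0 a ha)) (hprod a ha)
          exact (Nat.sub_le _ _).trans (Nat.sub_le _ _)
      _ = (4 * 10 ^ 8) * n ^ 16 := by ring
      _ ≤ _ := le_polyBound hn (by norm_num) (by norm_num)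
  · intro a ha
    have h2 := (unitFractionReps_four_bounds hn (hS a ha)).2.1
    exact sq_le_polyBound hn ((Nat.le_mul_of_pos_right _ ((hS a ha).1 0)).trans h2) (hprod a ha)
  · intro a ha b hb h
    rw [firstIndex_add hm hn (hS a ha), firstIndex_add hm hn (hS b hb), h]
  · intro a ha b hb h0 h1 h2 h3
    funext i
    fin_cases i
    · exact h0
    · exact h1
    · exact h2
    · exact h3

end Families

/-! ### Size inequalities between the parameters -/

namespace TripleParam.Valid

variable {p : TripleParam} {u N b₁ b₂ b₃ : ℕ}

theorem w_mul_y₂_mul_y₃_le (h : p.Valid u N b₁ b₂ b₃) (hN : 0 < N) : p.w * p.y₂ * p.y₃ ≤ b₁ := by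
  refine Nat.le_of_mul_le_mul_left ?_ hN
  rw [← h.eq₁, mul_comm]
  exact Nat.mul_le_mul_right _ (Nat.le_of_dvd hN h.dvd₁)

/-- The product `b i * d i * y i` equals `N L` for every `i`, so `d i y i` decreases as `b i` grows.
-/
theorem antitone₁₂ (h : p.Valid u N b₁ b₂ b₃) (hb : b₁ ≤ b₂) (hb₁ : 0 < b₁) :
    p.d₂ * p.y₂ ≤ p.d₁ * p.y₁ := by
  refine Nat.le_of_mul_le_mul_left ?_ hb₁
  calc b₁ * (p.d₂ * p.y₂) ≤ b₂ * p.d₂ * p.y₂ := by rw [mul_assoc]; gcongr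
    _ = b₁ * p.d₁ * p.y₁ := by rw [h.eq₁, h.eq₂]; ring
    _ = _ := by ring

theorem antitone₂₃ (h : p.Valid u N b₁ b₂ b₃) (hb : b₂ ≤ b₃) (hb₂ : 0 < b₂) :
    p.d₃ * p.y₃ ≤ p.d₂ * p.y₂ := by
  refine Nat.le_of_mul_le_mul_left ?_ hb₂
  calc b₂ * (p.d₃ * p.y₃) ≤ b₃ * p.d₃ * p.y₃ := by rw [mul_assoc]; gcongr
    _ = b₂ * p.d₂ * p.y₂ := by rw [h.eq₂, h.eq₃]; ring
    _ = _ := by ring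

/-- By monotonicity, `y₃ quot₃ ≤ 2 (d₁ / g) y₁` and `y₁ quot₁ ≤ 2 d₂ y₂` with `g = gcd d₁ d₂`. In
the product of the two, `y₁` cancels and `(d₁ / g) d₂ = lcm d₁ d₂ ≤ N`. -/
theorem y₃_mul_quot₃_mul_quot₁_le (h : p.Valid u N b₁ b₂ b₃) (hN : 0 < N) (hb₁ : 0 < b₁)
    (h₁₂ : b₁ ≤ b₂) (h₂₃ : b₂ ≤ b₃) : p.y₃ * p.quot₃ * p.quot₁ ≤ 4 * N * p.y₂ := by
  set g := p.d₁.gcd p.d₂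
  have hg : 0 < g := Nat.gcd_pos_of_pos_left _ (h.d₁_pos hN)
  have e₁ : g * (p.d₁ / g) = p.d₁ := Nat.mul_div_cancel' (Nat.gcd_dvd_left _ _)
  have e₂ : g * (p.d₂ / g) = p.d₂ := Nat.mul_div_cancel' (Nat.gcd_dvd_right _ _)
  have i₃ : p.y₃ * p.quot₃ ≤ 2 * (p.d₁ / g) * p.y₁ := by
    refine Nat.le_of_mul_le_mul_left ?_ hg
    rw [h.y₃_mul_quot₃]
    calc g * (p.d₁ / g * p.y₁ + p.d₂ / g * p.y₂) = g * (p.d₁ / g) * p.y₁ + g * (p.d₂ / g) * p.y₂ := by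
          ring
      _ ≤ 2 * (g * (p.d₁ / g)) * p.y₁ := by
          rw [e₁, e₂]
          linarith [h.antitone₁₂ h₁₂ hb₁]
      _ = _ := by ring
  have i₁ : p.y₁ * p.quot₁ ≤ 2 * p.d₂ * p.y₂ := by
    rw [h.y₁_mul_quot₁]
    linarith [h.antitone₂₃ h₂₃ (hb₁.trans_le h₁₂)]
  have hlcm : p.d₁ / g * p.d₂ ≤ N := by
    have h1 : p.d₁ / g * p.d₂ = p.d₁.lcm p.d₂ := by
      refine Nat.eq_of_mul_eq_mul_left hg ?_
      rw [Nat.gcd_mul_lcm, ← mul_assoc, e₁]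
    rw [h1]
    exact Nat.le_of_dvd hN (Nat.lcm_dvd h.dvd₁ h.dvd₂)
  refine Nat.le_of_mul_le_mul_left ?_ h.y₁_pos
  calc p.y₁ * (p.y₃ * p.quot₃ * p.quot₁) = (p.y₃ * p.quot₃) * (p.y₁ * p.quot₁) := by ring
    _ ≤ (2 * (p.d₁ / g) * p.y₁) * (2 * p.d₂ * p.y₂) := Nat.mul_le_mul i₃ i₁
    _ = p.y₁ * (4 * (p.d₁ / g * p.d₂) * p.y₂) := by ring
    _ ≤ p.y₁ * (4 * N * p.y₂) := by gcongr

end TripleParam.Valid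

namespace QuadParam.Valid

variable {p : QuadParam} {m n a₁ a₂ a₃ a₄ : ℕ}

theorem h₁₂_mul_quot_le (h : p.Valid m n a₁ a₂ a₃ a₄) (ha : a₃ ≤ a₄) (ha₃ : 0 < a₃) :
    p.h₁₂ * p.quot ≤ 2 * p.d₃ * (p.h₁₃ * p.h₂₃ * p.s₃) := by
  have h1 : p.d₄ * (p.h₁₄ * p.h₂₄ * p.s₄) ≤ p.d₃ * (p.h₁₃ * p.h₂₃ * p.s₃) := by
    refine Nat.le_of_mul_le_mul_left ?_ ha₃
    calc a₃ * (p.d₄ * (p.h₁₄ * p.h₂₄ * p.s₄)) ≤ a₄ * (p.d₄ * (p.h₁₄ * p.h₂₄ * p.s₄)) :=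
          Nat.mul_le_mul_right _ ha
      _ = a₄ * p.d₄ * (p.h₁₄ * p.h₂₄ * p.s₄) := by ring
      _ = a₃ * p.d₃ * (p.h₁₃ * p.h₂₃ * p.s₃) := by rw [h.eq₃, h.eq₄]; ring
      _ = _ := by ring
  rw [h.h₁₂_mul_quot]
  linarith

theorem keyA_mul_keyC_le (h : p.Valid m n a₁ a₂ a₃ a₄) (hn : 0 < n) (ha : a₃ ≤ a₄) (ha₁ : 0 < a₁)
    (ha₂ : 0 < a₂) (ha₃ : 0 < a₃) (j : ℕ) :
    p.keyA * (j * p.h₁₄ * p.s₁) ^ 2 * p.keyC ≤ 2 * n * a₁ * (j * a₂) ^ 2 := by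
  have hpos : 0 < p.w * p.h₃₄ * p.s₄ := Nat.mul_pos (Nat.mul_pos h.w_pos h.h₃₄_pos) h.s₄_pos
  calc p.keyA * (j * p.h₁₄ * p.s₁) ^ 2 * p.keyC
      = p.h₁₂ * p.quot * (p.h₁₃ * p.h₂₄ * p.h₃₄ ^ 2 * p.s₂ * p.s₃ ^ 2 * p.s₄ ^ 2 * p.w ^ 2 *
        (j * p.h₁₄ * p.s₁) ^ 2) := by unfold keyA keyC; ring
    _ ≤ 2 * p.d₃ * (p.h₁₃ * p.h₂₃ * p.s₃) * (p.h₁₃ * p.h₂₄ * p.h₃₄ ^ 2 * p.s₂ * p.s₃ ^ 2 *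
        p.s₄ ^ 2 * p.w ^ 2 * (j * p.h₁₄ * p.s₁) ^ 2) :=
        Nat.mul_le_mul_right _ (h.h₁₂_mul_quot_le ha ha₃)
    -- The inserted factor `w h₃₄ s₄ ≥ 1` completes the monomial to `t₁ t₂²`, where `t₁ ∣ a₁` and
    -- `t₂ ∣ a₂`.
    _ ≤ 2 * p.d₃ * (p.h₁₃ * p.h₂₃ * p.s₃) * (p.h₁₃ * p.h₂₄ * p.h₃₄ ^ 2 * p.s₂ * p.s₃ ^ 2 *
        p.s₄ ^ 2 * p.w ^ 2 * (j * p.h₁₄ * p.s₁) ^ 2) * (p.w * p.h₃₄ * p.s₄) :=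
        Nat.le_mul_of_pos_right _ hpos
    _ = 2 * p.d₃ * (p.w * p.h₂₃ * p.h₂₄ * p.h₃₄ * p.s₂ * p.s₃ * p.s₄) *
        (j * (p.w * p.h₁₃ * p.h₁₄ * p.h₃₄ * p.s₁ * p.s₃ * p.s₄)) ^ 2 := by ring
    _ ≤ 2 * n * a₁ * (j * a₂) ^ 2 := by
        gcongr
        · exact Nat.le_of_dvd hn h.dvd₃
        · exact Nat.le_of_dvd ha₁ (h.dvd_a₁ hn)
        · exact Nat.le_of_dvd ha₂ (h.dvd_a₂ hn)

end QuadParam.Valid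

/-! ### Bounds for the two ranges of the first denominator -/

section Counting

variable {m n : ℕ} {S : Finset (Fin 4 → ℕ)}

/-- Representations whose first denominator is as small as possible. -/
theorem card_le_of_firstIndex_eq_zero (hm : 0 < m) (hn : 0 < n)
    (hS : ∀ a ∈ S, a ∈ unitFractionReps 4 m n) (hj : ∀ a ∈ S, firstIndex m n a = 0) :
    (S.card : ℝ) ≤ 20 * ((n : ℝ) ^ (6 / 5 : ℝ) / (m : ℝ) ^ (3 / 5 : ℝ)) *
      (maxDivisors (polyBound n) : ℝ) ^ 6 := by
  obtain ⟨p, h⟩ := exists_tripleFamily hm hn hS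
  have hm' : (0 : ℝ) < m := by exact_mod_cast hm
  have hn' : (0 : ℝ) < n := by exact_mod_cast hn
  -- The keys enter with total exponent 5, and `5 ^ 5 = 3125` exceeds the constant `36 * 4 ^ 3 =
  -- 2304` found below.
  set B : ℝ := 5 * ((n : ℝ) ^ (6 / 5 : ℝ) / (m : ℝ) ^ (3 / 5 : ℝ)) with hB
  have hB0 : 0 ≤ B := by positivity
  have hB5 : B ^ 5 = 3125 * (n ^ 6 / m ^ 3) := by
    rw [hB, mul_pow, div_pow, ← Real.rpow_natCast (_ ^ (6 / 5 : ℝ)), ← Real.rpow_mul hn'.le,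
      ← Real.rpow_natCast (_ ^ (3 / 5 : ℝ)), ← Real.rpow_mul hm'.le]
    norm_num
  have h0 : ∀ a ∈ S, a 0 = n / m + 1 := fun a ha => by
    rw [firstIndex_add hm hn (hS a ha), hj a ha, zero_add]
  have h0' : ∀ a ∈ S, ∀ b ∈ S, m * a 0 - n = m * b 0 - n ∧ n * a 0 = n * b 0 :=
    fun a ha b hb => by rw [h0 a ha, h0 b hb]; exact ⟨rfl, rfl⟩
  have hle : ∀ a ∈ S, ∀ k, k ∣ (p a).w * (p a).y₁ * (p a).y₂ * (p a).y₃ →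
      0 < k ∧ k ≤ polyBound n := fun a ha k hk => by
    have v := h.valid a ha
    have hpos : 0 < (p a).w * (p a).y₁ * (p a).y₂ * (p a).y₃ :=
      Nat.mul_pos (Nat.mul_pos (Nat.mul_pos v.w_pos v.y₁_pos) v.y₂_pos) v.y₃_pos
    exact ⟨Nat.pos_of_dvd_of_pos hk hpos, h.le_X ha
      ((Nat.le_of_dvd hpos hk).trans (Nat.le_mul_of_pos_left _ (h.u_pos a ha)))⟩
  have hkey := card_le_of_keys (S := S) (K := maxDivisors (polyBound n) ^ 6) (k := 4)
    (g := ![fun a => (p a).quot₃, fun a => (p a).quot₁, fun a => (p a).y₃ * (p a).w,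
      fun a => (p a).y₂ * (p a).y₃]) ?_ hB0 ?_ ?_
  · refine hkey.trans (le_of_eq ?_)
    rw [hB]
    push_cast
    ring
  · intro i
    fin_cases i
    · exact h.fiberBound_quot₃ fun a ha b hb hab => ⟨(h0' a ha b hb).1, (h0' a ha b hb).2, hab⟩
    · exact h.fiberBound_quot₁ fun a ha b hb hab => ⟨(h0' a ha b hb).1, (h0' a ha b hb).2, hab⟩
    · rw [show maxDivisors (polyBound n) ^ 6 =
        maxDivisors (polyBound n) ^ 2 * maxDivisors (polyBound n) ^ 4 by ring]
      refine .of_dvd_pair (fun a => (p a).y₃) (fun a => (p a).w) (fun a => (p a).y₃ * (p a).w)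
        (fun a ha => ⟨rfl, hle a ha _ ⟨(p a).y₁ * (p a).y₂, by ring⟩⟩)
        (fun a ha b hb hab => hab) ?_
      refine h.fiberBound_y₃_w fun a ha b hb hab => ?_
      simp only [Prod.mk.injEq] at hab
      exact ⟨(h0' a ha b hb).1, (h0' a ha b hb).2, hab.1.2, hab.2⟩
    · rw [show maxDivisors (polyBound n) ^ 6 =
        maxDivisors (polyBound n) ^ 2 * maxDivisors (polyBound n) ^ 4 by ring]
      refine .of_dvd_pair (fun a => (p a).y₂) (fun a => (p a).y₃) (fun a => (p a).y₂ * (p a).y₃)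
        (fun a ha => ⟨rfl, hle a ha _ ⟨(p a).w * (p a).y₁, by ring⟩⟩)
        (fun a ha b hb hab => hab) ?_
      refine h.fiberBound_y₂_y₃ fun a ha b hb hab => ?_
      simp only [Prod.mk.injEq] at hab
      exact ⟨(h0' a ha b hb).1, (h0' a ha b hb).2, hab.1.2, hab.2⟩
  · intro a ha i
    have v := h.valid a ha
    fin_cases i
    · exact v.quot₃_pos (h.N_pos a ha)
    · exact v.quot₁_pos (h.N_pos a ha)
    · exact Nat.mul_pos v.y₃_pos v.w_pos
    · exact Nat.mul_pos v.y₂_pos v.y₃_pos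
  · intro a ha
    by_contra! hcon
    have v := h.valid a ha
    obtain ⟨hpos, hmono, -⟩ := hS a ha
    obtain ⟨i1, i2, i3, -⟩ := unitFractionReps_four_bounds hn (hS a ha)
    have k0 : B < ((p a).quot₃ : ℝ) := hcon 0
    have k1 : B < ((p a).quot₁ : ℝ) := hcon 1
    have k2 : B < (((p a).y₃ * (p a).w : ℕ) : ℝ) := hcon 2
    have k3 : B < (((p a).y₂ * (p a).y₃ : ℕ) : ℝ) := hcon 3
    -- The exponents are chosen so that, after `y₃ quot₃ quot₁ ≤ 4 N y₂`, exactly `(w y₂ y₃)²`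
    -- remains, and `w y₂ y₃ ≤ a 1 ≤ 3 N`.
    have e1 : (p a).quot₃ * (p a).quot₁ * ((p a).y₃ * (p a).w) ^ 2 * ((p a).y₂ * (p a).y₃) ≤
        36 * (n * a 0) ^ 3 := by
      have j1 := v.y₃_mul_quot₃_mul_quot₁_le (h.N_pos a ha) (hpos 1) (hmono (by decide))
        (hmono (by decide))
      have j2 : (p a).w * (p a).y₂ * (p a).y₃ ≤ 3 * (n * a 0) := by
        refine (v.w_mul_y₂_mul_y₃_le (h.N_pos a ha)).trans ?_
        calc a 1 ≤ (m * a 0 - n) * a 1 := Nat.le_mul_of_pos_left _ (by omega)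
          _ ≤ 3 * n * a 0 := i3
          _ = _ := by ring
      calc _ = (p a).y₃ * (p a).quot₃ * (p a).quot₁ * ((p a).y₃ ^ 2 * (p a).w ^ 2 * (p a).y₂) := by
            ring
        _ ≤ 4 * (n * a 0) * (p a).y₂ * ((p a).y₃ ^ 2 * (p a).w ^ 2 * (p a).y₂) :=
            Nat.mul_le_mul_right _ j1
        _ = 4 * (n * a 0) * ((p a).w * (p a).y₂ * (p a).y₃) ^ 2 := by ring
        _ ≤ 4 * (n * a 0) * (3 * (n * a 0)) ^ 2 := by gcongr
        _ = _ := by ring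
    have e2 : (p a).quot₃ * (p a).quot₁ * ((p a).y₃ * (p a).w) ^ 2 * ((p a).y₂ * (p a).y₃) * m ^ 3 ≤
        3125 * n ^ 6 := by
      calc _ ≤ 36 * (n * a 0) ^ 3 * m ^ 3 := Nat.mul_le_mul_right _ e1
        _ = 36 * n ^ 3 * (m * a 0) ^ 3 := by ring
        _ ≤ 36 * n ^ 3 * (4 * n) ^ 3 := by gcongr
        _ = 2304 * n ^ 6 := by ring
        _ ≤ _ := Nat.mul_le_mul_right _ (by norm_num)
    have e3 : B ^ 5 < (p a).quot₃ * (p a).quot₁ * (((p a).y₃ * (p a).w : ℕ) : ℝ) ^ 2 *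
        (((p a).y₂ * (p a).y₃ : ℕ) : ℝ) := by
      calc B ^ 5 = B * B * B ^ 2 * B := by ring
        _ < _ := by gcongr
    rw [hB5, ← mul_div_assoc, div_lt_iff₀ (by positivity)] at e3
    have e4 : ((p a).quot₃ * (p a).quot₁ * (((p a).y₃ * (p a).w : ℕ) : ℝ) ^ 2 *
        (((p a).y₂ * (p a).y₃ : ℕ) : ℝ)) * m ^ 3 ≤ 3125 * n ^ 6 := by exact_mod_cast e2
    exact absurd e3 (not_lt.mpr e4)

theorem firstIndex_mul_le (hm : 0 < m) (hn : 0 < n) {a : Fin 4 → ℕ}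
    (ha : a ∈ unitFractionReps 4 m n) : m * (firstIndex m n a * a 1) ≤ 3 * n * a 0 := by
  rw [← mul_assoc]
  exact (Nat.mul_le_mul_right _ (mul_firstIndex_le hm hn ha)).trans
    (unitFractionReps_four_bounds hn ha).2.2.1

theorem firstIndex_le (a : Fin 4 → ℕ) : firstIndex m n a ≤ a 0 :=
  (Nat.sub_le _ _).trans (Nat.sub_le _ _)

/-- Bound for the remaining representations through sums of three unit fractions. -/
theorem card_le_of_firstIndex_pos (hm : 0 < m) (hn : 0 < n)
    (hS : ∀ a ∈ S, a ∈ unitFractionReps 4 m n) (hj : ∀ a ∈ S, 0 < firstIndex m n a) :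
    (S.card : ℝ) ≤ 27 * ((n : ℝ) ^ (5 / 3 : ℝ) / (m : ℝ) ^ (5 / 3 : ℝ)) *
      (maxDivisors (polyBound n) : ℝ) ^ 7 := by
  obtain ⟨p, h⟩ := exists_tripleFamily hm hn hS
  have hm' : (0 : ℝ) < m := by exact_mod_cast hm
  have hn' : (0 : ℝ) < n := by exact_mod_cast hn
  -- Three keys of exponent 1, with `9 ^ 3 = 729` above the constant `9 * 4 ^ 3 = 576` found below.
  set B : ℝ := 9 * ((n : ℝ) ^ (5 / 3 : ℝ) / (m : ℝ) ^ (5 / 3 : ℝ)) with hB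
  have hB0 : 0 ≤ B := by positivity
  have hB3 : B ^ 3 = 729 * (n ^ 5 / m ^ 5) := by
    rw [hB, mul_pow, div_pow, ← Real.rpow_natCast (_ ^ (5 / 3 : ℝ)), ← Real.rpow_mul hn'.le,
      ← Real.rpow_natCast (_ ^ (5 / 3 : ℝ)), ← Real.rpow_mul hm'.le]
    norm_num
  have h0 : ∀ a ∈ S, ∀ b ∈ S, firstIndex m n a = firstIndex m n b →
      m * a 0 - n = m * b 0 - n ∧ n * a 0 = n * b 0 := fun a ha b hb hab => by
    rw [firstIndex_add hm hn (hS a ha), firstIndex_add hm hn (hS b hb), hab]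
    exact ⟨rfl, rfl⟩
  have hle : ∀ a ∈ S, ∀ k, k ∣ (p a).w * (p a).y₁ * (p a).y₂ * (p a).y₃ →
      0 < firstIndex m n a * k ∧ firstIndex m n a * k ≤ polyBound n := fun a ha k hk => by
    have v := h.valid a ha
    obtain ⟨b0, b1, b2, b3⟩ := unitFractionReps_four_le hm hn (hS a ha)
    have hpos : 0 < (p a).w * (p a).y₁ * (p a).y₂ * (p a).y₃ :=
      Nat.mul_pos (Nat.mul_pos (Nat.mul_pos v.w_pos v.y₁_pos) v.y₂_pos) v.y₃_pos
    have hpos' := (hS a ha).1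
    refine ⟨Nat.mul_pos (hj a ha) (Nat.pos_of_dvd_of_pos hk hpos), ?_⟩
    calc firstIndex m n a * k ≤ a 0 * (a 1 * a 2 * a 3) :=
          Nat.mul_le_mul (firstIndex_le a) (Nat.le_of_dvd
            (Nat.mul_pos (Nat.mul_pos (hpos' 1) (hpos' 2)) (hpos' 3)) (hk.trans v.dvd_prod))
      _ ≤ 4 * n * (12 * n ^ 2 * (96 * n ^ 4) * (4608 * n ^ 8)) := by gcongr
      _ = 21233664 * n ^ 15 := by ring
      _ ≤ _ := le_polyBound hn (by norm_num) (by norm_num)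
  -- The index is a factor of each key because it determines `a 0`, hence the fraction left for the
  -- other three terms. Splitting the key costs three divisor functions.
  have hfib : ∀ x y : TripleParam → ℕ,
      (∀ q : TripleParam, x q * y q ∣ q.w * q.y₁ * q.y₂ * q.y₃) →
      FiberBound S (fun a => (((firstIndex m n a * (x (p a) * y (p a)), firstIndex m n a),
        x (p a)), y (p a))) (maxDivisors (polyBound n) ^ 4) →
      FiberBound S (fun a => firstIndex m n a * (x (p a) * y (p a)))
        (maxDivisors (polyBound n) ^ 7) := by
    intro x y hxy hK
    set R : (Fin 4 → ℕ) → ℕ := fun a => firstIndex m n a * (x (p a) * y (p a))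
    have hR : ∀ a ∈ S, 0 < R a ∧ R a ≤ polyBound n := fun a ha => hle a ha _ (hxy _)
    rw [show maxDivisors (polyBound n) ^ 7 = maxDivisors (polyBound n) * (maxDivisors (polyBound n) *
      (maxDivisors (polyBound n) * maxDivisors (polyBound n) ^ 4)) by ring]
    refine .of_dvd (firstIndex m n) R (fun a ha => ⟨Dvd.intro _ rfl, hR a ha⟩)
      (fun a ha b hb hab => hab) ?_
    refine .of_dvd (fun a => x (p a)) R
      (fun a ha => ⟨⟨firstIndex m n a * y (p a), by simp only [R]; ring⟩, hR a ha⟩)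
      (fun a ha b hb hab => (Prod.ext_iff.mp hab).1) ?_
    exact .of_dvd (fun a => y (p a)) R
      (fun a ha => ⟨⟨firstIndex m n a * x (p a), by simp only [R]; ring⟩, hR a ha⟩)
      (fun a ha b hb hab => (Prod.ext_iff.mp (Prod.ext_iff.mp hab).1).1) hK
  have hkey := card_le_of_keys (S := S) (K := maxDivisors (polyBound n) ^ 7) (k := 3)
    (g := ![fun a => firstIndex m n a * ((p a).y₂ * (p a).y₃),
      fun a => firstIndex m n a * ((p a).y₂ * (p a).w),
      fun a => firstIndex m n a * ((p a).y₃ * (p a).w)]) ?_ hB0 ?_ ?_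
  · refine hkey.trans (le_of_eq ?_)
    rw [hB]
    push_cast
    ring
  · intro i
    fin_cases i
    · refine hfib TripleParam.y₂ TripleParam.y₃ (fun q => ⟨q.w * q.y₁, by ring⟩) ?_
      refine h.fiberBound_y₂_y₃ fun a ha b hb hab => ?_
      simp only [Prod.mk.injEq] at hab
      exact ⟨(h0 a ha b hb hab.1.1.2).1, (h0 a ha b hb hab.1.1.2).2, hab.1.2, hab.2⟩
    · refine hfib TripleParam.y₂ TripleParam.w (fun q => ⟨q.y₁ * q.y₃, by ring⟩) ?_
      refine h.fiberBound_y₂_w fun a ha b hb hab => ?_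
      simp only [Prod.mk.injEq] at hab
      exact ⟨(h0 a ha b hb hab.1.1.2).1, (h0 a ha b hb hab.1.1.2).2, hab.1.2, hab.2⟩
    · refine hfib TripleParam.y₃ TripleParam.w (fun q => ⟨q.y₁ * q.y₂, by ring⟩) ?_
      refine h.fiberBound_y₃_w fun a ha b hb hab => ?_
      simp only [Prod.mk.injEq] at hab
      exact ⟨(h0 a ha b hb hab.1.1.2).1, (h0 a ha b hb hab.1.1.2).2, hab.1.2, hab.2⟩
  · intro a ha i
    fin_cases i
    · exact (hle a ha _ ⟨(p a).w * (p a).y₁, by ring⟩).1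
    · exact (hle a ha _ ⟨(p a).y₁ * (p a).y₃, by ring⟩).1
    · exact (hle a ha _ ⟨(p a).y₁ * (p a).y₂, by ring⟩).1
  · intro a ha
    by_contra! hcon
    have v := h.valid a ha
    have i2 := (unitFractionReps_four_bounds hn (hS a ha)).2.1
    set j := firstIndex m n a
    have k0 : B < ((j * ((p a).y₂ * (p a).y₃) : ℕ) : ℝ) := hcon 0
    have k1 : B < ((j * ((p a).y₂ * (p a).w) : ℕ) : ℝ) := hcon 1
    have k2 : B < ((j * ((p a).y₃ * (p a).w) : ℕ) : ℝ) := hcon 2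
    have e2 : j * ((p a).y₂ * (p a).y₃) * (j * ((p a).y₂ * (p a).w)) *
        (j * ((p a).y₃ * (p a).w)) * m ^ 5 ≤ 729 * n ^ 5 := by
      calc _ = m ^ 3 * j * (m * (j * ((p a).w * (p a).y₂ * (p a).y₃))) ^ 2 := by ring
        _ ≤ m ^ 3 * a 0 * (m * (j * a 1)) ^ 2 := by
            gcongr
            · exact firstIndex_le a
            · exact v.w_mul_y₂_mul_y₃_le (h.N_pos a ha)
        _ ≤ m ^ 3 * a 0 * (3 * n * a 0) ^ 2 := Nat.mul_le_mul_left _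
            (Nat.pow_le_pow_left (firstIndex_mul_le hm hn (hS a ha)) 2)
        _ = 9 * n ^ 2 * (m * a 0) ^ 3 := by ring
        _ ≤ 9 * n ^ 2 * (4 * n) ^ 3 := by gcongr
        _ = 576 * n ^ 5 := by ring
        _ ≤ _ := Nat.mul_le_mul_right _ (by norm_num)
    have e3 : B ^ 3 < ((j * ((p a).y₂ * (p a).y₃) : ℕ) : ℝ) * ((j * ((p a).y₂ * (p a).w) : ℕ) : ℝ) *
        ((j * ((p a).y₃ * (p a).w) : ℕ) : ℝ) := by
      calc B ^ 3 = B * B * B := by ring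
        _ < _ := by gcongr
    rw [hB3, ← mul_div_assoc, div_lt_iff₀ (by positivity)] at e3
    have e4 : ((j * ((p a).y₂ * (p a).y₃) : ℕ) : ℝ) * ((j * ((p a).y₂ * (p a).w) : ℕ) : ℝ) *
        ((j * ((p a).y₃ * (p a).w) : ℕ) : ℝ) * m ^ 5 ≤ 729 * n ^ 5 := by exact_mod_cast e2
    exact absurd e3 (not_lt.mpr e4)

/-- Bound for the remaining representations through the parametrization of all four terms. -/
theorem card_le_of_firstIndex_pos' (hm : 0 < m) (hn : 0 < n)
    (hS : ∀ a ∈ S, a ∈ unitFractionReps 4 m n) (hj : ∀ a ∈ S, 0 < firstIndex m n a) :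
    (S.card : ℝ) ≤ 18 * ((n : ℝ) ^ (3 / 2 : ℝ) / (m : ℝ) ^ (5 / 4 : ℝ)) *
      (maxDivisors (polyBound n) : ℝ) ^ 17 := by
  obtain ⟨p, h⟩ := exists_quadFamily hm hn hS hj
  have hm' : (0 : ℝ) < m := by exact_mod_cast hm
  have hn' : (0 : ℝ) < n := by exact_mod_cast hn
  have hT : 1 ≤ maxDivisors (polyBound n) :=
    one_le_maxDivisors (polyBound_pos hn)
  -- Total exponent 4, with `6 ^ 4 = 1296` above the constant `18 * 4 ^ 3 = 1152` found below.
  set B : ℝ := 6 * ((n : ℝ) ^ (3 / 2 : ℝ) / (m : ℝ) ^ (5 / 4 : ℝ)) with hB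
  have hB0 : 0 ≤ B := by positivity
  have hB4 : B ^ 4 = 1296 * (n ^ 6 / m ^ 5) := by
    rw [hB, mul_pow, div_pow, ← Real.rpow_natCast (_ ^ (3 / 2 : ℝ)), ← Real.rpow_mul hn'.le,
      ← Real.rpow_natCast (_ ^ (5 / 4 : ℝ)), ← Real.rpow_mul hm'.le]
    norm_num
  have hkey := card_le_of_keys (S := S) (K := maxDivisors (polyBound n) ^ 17) (k := 3)
    (g := ![fun a => (p a).keyA, fun a => firstIndex m n a * (p a).h₁₄ * (p a).s₁,
      fun a => (p a).keyC]) ?_ hB0 ?_ ?_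
  · refine hkey.trans (le_of_eq ?_)
    rw [hB]
    push_cast
    ring
  · intro i
    fin_cases i
    · exact h.fiberBound_keyA.mono (Nat.pow_le_pow_right hT (by norm_num))
    · exact h.fiberBound_keyB.mono (Nat.pow_le_pow_right hT (by norm_num))
    · exact h.fiberBound_keyC
  · intro a ha i
    have v := h.valid a ha
    fin_cases i
    · exact v.keyA_pos
    · exact Nat.mul_pos (Nat.mul_pos (hj a ha) v.h₁₄_pos) v.s₁_pos
    · exact v.keyC_pos hn
  · intro a ha
    by_contra! hcon
    have v := h.valid a ha
    obtain ⟨hpos, hmono, -⟩ := hS a ha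
    have i2 := (unitFractionReps_four_bounds hn (hS a ha)).2.1
    set j := firstIndex m n a
    have k0 : B < ((p a).keyA : ℝ) := hcon 0
    have k1 : B < ((j * (p a).h₁₄ * (p a).s₁ : ℕ) : ℝ) := hcon 1
    have k2 : B < ((p a).keyC : ℝ) := hcon 2
    have e2 : (p a).keyA * (j * (p a).h₁₄ * (p a).s₁) ^ 2 * (p a).keyC * m ^ 5 ≤ 1296 * n ^ 6 := by
      calc _ ≤ 2 * n * a 0 * (j * a 1) ^ 2 * m ^ 5 :=
            Nat.mul_le_mul_right _ (v.keyA_mul_keyC_le hn (hmono (by decide)) (hpos 0) (hpos 1)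
              (hpos 2) j)
        _ = 2 * n * a 0 * (m * (j * a 1)) ^ 2 * m ^ 3 := by ring
        _ ≤ 2 * n * a 0 * (3 * n * a 0) ^ 2 * m ^ 3 := Nat.mul_le_mul_right _
            (Nat.mul_le_mul_left _ (Nat.pow_le_pow_left (firstIndex_mul_le hm hn (hS a ha)) 2))
        _ = 18 * n ^ 3 * (m * a 0) ^ 3 := by ring
        _ ≤ 18 * n ^ 3 * (4 * n) ^ 3 := by gcongr
        _ = 1152 * n ^ 6 := by ring
        _ ≤ _ := Nat.mul_le_mul_right _ (by norm_num)
    have e3 : B ^ 4 < ((p a).keyA : ℝ) * ((j * (p a).h₁₄ * (p a).s₁ : ℕ) : ℝ) ^ 2 *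
        ((p a).keyC : ℝ) := by
      calc B ^ 4 = B * B ^ 2 * B := by ring
        _ < _ := by gcongr
    rw [hB4, ← mul_div_assoc, div_lt_iff₀ (by positivity)] at e3
    have e4 : ((p a).keyA : ℝ) * ((j * (p a).h₁₄ * (p a).s₁ : ℕ) : ℝ) ^ 2 *
        ((p a).keyC : ℝ) * m ^ 5 ≤ 1296 * n ^ 6 := by exact_mod_cast e2
    exact absurd e3 (not_lt.mpr e4)

end Counting

/-! ### Comparison of the bounds -/

theorem rpow_div_rpow_le {x y a b c d : ℝ} (hx : 1 ≤ x) (hy : 1 ≤ y)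
    (h : a * Real.log x - b * Real.log y ≤ Real.log 4 + (c * Real.log x - d * Real.log y)) :
    x ^ a / y ^ b ≤ 4 * (x ^ c / y ^ d) := by
  have hx0 : 0 < x := by linarith
  have hy0 : 0 < y := by linarith
  have e : ∀ s t : ℝ, x ^ s / y ^ t = Real.exp (s * Real.log x - t * Real.log y) := fun s t => by
    rw [Real.exp_sub, Real.rpow_def_of_pos hx0, Real.rpow_def_of_pos hy0, mul_comm s, mul_comm t]
  rw [e, e]
  calc _ ≤ Real.exp (Real.log 4 + (c * Real.log x - d * Real.log y)) := Real.exp_le_exp.mpr h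
    _ = _ := by rw [Real.exp_add, Real.exp_log (by norm_num)]

/-- In logarithms, each comparison is a linear inequality on `0 ≤ log y ≤ log 4 + log x`. A factor 4
absorbs the `log 4`, and two summands on the left make 8. -/
theorem add_min_le_min {x y : ℝ} (hx : 1 ≤ x) (hy : 1 ≤ y) (hxy : y ≤ 4 * x) :
    x ^ (6 / 5 : ℝ) / y ^ (3 / 5 : ℝ) +
      min (x ^ (3 / 2 : ℝ) / y ^ (5 / 4 : ℝ)) (x ^ (5 / 3 : ℝ) / y ^ (5 / 3 : ℝ)) ≤
    8 * min (min (x ^ (3 / 2 : ℝ) / y ^ (3 / 4 : ℝ)) (x ^ (8 / 5 : ℝ) / y))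
      (min (x ^ (4 / 3 : ℝ) / y ^ (2 / 3 : ℝ) + x ^ (28 / 17 : ℝ) / y ^ (8 / 5 : ℝ))
        ((x / y) ^ (5 / 3 : ℝ) + x ^ (4 / 3 : ℝ) / y ^ (2 / 3 : ℝ))) := by
  have hx0 : 0 < x := by linarith
  have hy0 : 0 < y := by linarith
  have hp : 0 ≤ Real.log x := Real.log_nonneg hx
  have hq : 0 ≤ Real.log y := Real.log_nonneg hy
  have hl : 0 ≤ Real.log 4 := Real.log_nonneg (by norm_num)
  have hpq : Real.log y ≤ Real.log 4 + Real.log x := by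
    rw [← Real.log_mul (by norm_num) hx0.ne']
    exact Real.log_le_log hy0 hxy
  have hy1 : x ^ (8 / 5 : ℝ) / y = x ^ (8 / 5 : ℝ) / y ^ (1 : ℝ) := by rw [Real.rpow_one]
  rw [hy1, Real.div_rpow hx0.le hy0.le]
  have hpos : ∀ s t : ℝ, 0 ≤ x ^ s / y ^ t := fun s t => by positivity
  have f1 : x ^ (6 / 5 : ℝ) / y ^ (3 / 5 : ℝ) ≤ 4 * (x ^ (3 / 2 : ℝ) / y ^ (3 / 4 : ℝ)) :=
    rpow_div_rpow_le hx hy (by linarith)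
  have f2 : x ^ (6 / 5 : ℝ) / y ^ (3 / 5 : ℝ) ≤ 4 * (x ^ (8 / 5 : ℝ) / y ^ (1 : ℝ)) :=
    rpow_div_rpow_le hx hy (by linarith)
  have f3 : x ^ (6 / 5 : ℝ) / y ^ (3 / 5 : ℝ) ≤ 4 * (x ^ (4 / 3 : ℝ) / y ^ (2 / 3 : ℝ)) :=
    rpow_div_rpow_le hx hy (by linarith)
  have g1 : x ^ (3 / 2 : ℝ) / y ^ (5 / 4 : ℝ) ≤ 4 * (x ^ (3 / 2 : ℝ) / y ^ (3 / 4 : ℝ)) :=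
    rpow_div_rpow_le hx hy (by linarith)
  have g2 : x ^ (3 / 2 : ℝ) / y ^ (5 / 4 : ℝ) ≤ 4 * (x ^ (8 / 5 : ℝ) / y ^ (1 : ℝ)) :=
    rpow_div_rpow_le hx hy (by linarith)
  have g3 : min (x ^ (3 / 2 : ℝ) / y ^ (5 / 4 : ℝ)) (x ^ (5 / 3 : ℝ) / y ^ (5 / 3 : ℝ)) ≤
      4 * (x ^ (4 / 3 : ℝ) / y ^ (2 / 3 : ℝ) + x ^ (28 / 17 : ℝ) / y ^ (8 / 5 : ℝ)) := by
    have n1 := hpos (4 / 3) (2 / 3)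
    have n2 := hpos (28 / 17) (8 / 5)
    -- At `x = y ^ 3` the terms `(x / y) ^ (5/3)` and `x ^ (4/3) / y ^ (2/3)` agree. Above it, the
    -- bound with exponents `3/2`, `5/4` lies below the term with exponents `28/17`, `8/5`.
    rcases le_total (3 * Real.log y) (Real.log x) with hc | hc
    · have : x ^ (3 / 2 : ℝ) / y ^ (5 / 4 : ℝ) ≤ 4 * (x ^ (28 / 17 : ℝ) / y ^ (8 / 5 : ℝ)) :=
        rpow_div_rpow_le hx hy (by linarith)
      exact (min_le_left _ _).trans (by linarith)
    · have : x ^ (5 / 3 : ℝ) / y ^ (5 / 3 : ℝ) ≤ 4 * (x ^ (4 / 3 : ℝ) / y ^ (2 / 3 : ℝ)) :=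
        rpow_div_rpow_le hx hy (by linarith)
      exact (min_le_right _ _).trans (by linarith)
  have m1 := min_le_left (x ^ (3 / 2 : ℝ) / y ^ (5 / 4 : ℝ)) (x ^ (5 / 3 : ℝ) / y ^ (5 / 3 : ℝ))
  have m2 := min_le_right (x ^ (3 / 2 : ℝ) / y ^ (5 / 4 : ℝ)) (x ^ (5 / 3 : ℝ) / y ^ (5 / 3 : ℝ))
  have n2 := hpos (28 / 17) (8 / 5)
  have n3 := hpos (5 / 3) (5 / 3)
  have n4 := hpos (4 / 3) (2 / 3)
  rw [← div_le_iff₀' (by norm_num : (0 : ℝ) < 8)]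
  refine le_min (le_min ?_ ?_) (le_min ?_ ?_) <;> rw [div_le_iff₀' (by norm_num : (0 : ℝ) < 8)] <;>
    linarith

theorem exists_maxDivisors_polyBound_pow_le {ε : ℝ} (hε : 0 < ε) :
    ∃ C : ℝ, 0 < C ∧ ∀ n : ℕ, 0 < n →
      (maxDivisors (polyBound n) : ℝ) ^ 17 ≤ C * (n : ℝ) ^ ε := by
  -- `polyBound` has degree 32 in `n`, and its divisor bound is raised to the power 17.
  set δ : ℝ := ε / (32 * 17) with hδ
  obtain ⟨C, hC, h⟩ := exists_maxDivisors_le_rpow (ε := δ) (by positivity)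
  refine ⟨(C * ((10 : ℝ) ^ 18) ^ δ) ^ 17, by positivity, fun n hn => ?_⟩
  have h1 := h (polyBound n) (polyBound_pos hn)
  have h2 : ((polyBound n : ℕ) : ℝ) ^ δ = ((10 : ℝ) ^ 18) ^ δ * ((n : ℝ) ^ (32 * δ)) := by
    unfold polyBound
    push_cast
    rw [Real.mul_rpow (by positivity) (by positivity), ← Real.rpow_natCast (n : ℝ) 32,
      ← Real.rpow_mul (by positivity)]
    norm_num
  have h3 : ((n : ℝ) ^ (32 * δ)) ^ 17 = (n : ℝ) ^ ε := by
    rw [← Real.rpow_natCast, ← Real.rpow_mul (by positivity), hδ]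
    congr 1
    push_cast
    field_simp
  calc (maxDivisors (polyBound n) : ℝ) ^ 17 ≤ (C * ((polyBound n : ℕ) : ℝ) ^ δ) ^ 17 := by gcongr
    _ = _ := by rw [h2, ← mul_assoc, mul_pow _ ((n : ℝ) ^ (32 * δ)), h3]

theorem mainTheorem3 (ε : ℝ) (hε : 0 < ε) :
    ∃ C : ℝ, 0 < C ∧ ∀ m n : ℕ, 0 < m → 0 < n →
      (unitFractionReps 4 m n).Finite ∧
      (numUnitFractionReps 4 m n : ℝ) ≤
        C * (n : ℝ) ^ ε *
          min (min ((n : ℝ) ^ (3 / 2 : ℝ) / (m : ℝ) ^ (3 / 4 : ℝ))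
                   ((n : ℝ) ^ (8 / 5 : ℝ) / (m : ℝ)))
              (min ((n : ℝ) ^ (4 / 3 : ℝ) / (m : ℝ) ^ (2 / 3 : ℝ) +
                      (n : ℝ) ^ (28 / 17 : ℝ) / (m : ℝ) ^ (8 / 5 : ℝ))
                   (((n : ℝ) / (m : ℝ)) ^ (5 / 3 : ℝ) +
                      (n : ℝ) ^ (4 / 3 : ℝ) / (m : ℝ) ^ (2 / 3 : ℝ))) := by
  classical
  obtain ⟨C, hC, hT⟩ := exists_maxDivisors_polyBound_pow_le hε
  -- 27 is the largest of the counting constants 20, 18, 27, and 8 comes from comparing the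
  -- exponents.
  refine ⟨27 * 8 * C, by positivity, fun m n hm hn => ?_⟩
  have hfin := unitFractionReps_four_finite hm hn
  refine ⟨hfin, ?_⟩
  have hmem : ∀ a ∈ hfin.toFinset, a ∈ unitFractionReps 4 m n := fun a ha =>
    hfin.mem_toFinset.mp ha
  rw [numUnitFractionReps, Set.ncard_eq_toFinset_card _ hfin]
  -- A representation is needed to know `m ≤ 4 n`; without one the count is zero.
  rcases hfin.toFinset.eq_empty_or_nonempty with he | ⟨a, ha⟩
  · rw [he, Finset.card_empty, Nat.cast_zero]
    positivity
  have hx : (1 : ℝ) ≤ n := by exact_mod_cast hn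
  have hy : (1 : ℝ) ≤ m := by exact_mod_cast hm
  have hxy : (m : ℝ) ≤ 4 * n := by
    exact_mod_cast (Nat.le_mul_of_pos_right m ((hmem a ha).1 0)).trans
      (unitFractionReps_four_bounds hn (hmem a ha)).2.1
  set T : ℝ := (maxDivisors (polyBound n) : ℝ)
  have hT1 : 1 ≤ T := by
    exact Nat.one_le_cast.mpr (one_le_maxDivisors (polyBound_pos hn))
  set S₀ := hfin.toFinset.filter fun a => firstIndex m n a = 0
  set S₁ := hfin.toFinset.filter fun a => ¬ firstIndex m n a = 0
  have hcard : hfin.toFinset.card = S₀.card + S₁.card :=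
    (Finset.card_filter_add_card_filter_not _).symm
  have hS₀ : ∀ a ∈ S₀, a ∈ unitFractionReps 4 m n ∧ firstIndex m n a = 0 := fun a ha =>
    ⟨hmem a (Finset.mem_filter.mp ha).1, (Finset.mem_filter.mp ha).2⟩
  have hS₁ : ∀ a ∈ S₁, a ∈ unitFractionReps 4 m n ∧ 0 < firstIndex m n a := fun a ha =>
    ⟨hmem a (Finset.mem_filter.mp ha).1, Nat.pos_of_ne_zero (Finset.mem_filter.mp ha).2⟩
  have c₀ := card_le_of_firstIndex_eq_zero hm hn (fun a ha => (hS₀ a ha).1)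
    (fun a ha => (hS₀ a ha).2)
  have c₁ := card_le_of_firstIndex_pos' hm hn (fun a ha => (hS₁ a ha).1)
    (fun a ha => (hS₁ a ha).2)
  have c₂ := card_le_of_firstIndex_pos hm hn (fun a ha => (hS₁ a ha).1)
    (fun a ha => (hS₁ a ha).2)
  set E₀ : ℝ := (n : ℝ) ^ (6 / 5 : ℝ) / (m : ℝ) ^ (3 / 5 : ℝ)
  set E₁ : ℝ := (n : ℝ) ^ (3 / 2 : ℝ) / (m : ℝ) ^ (5 / 4 : ℝ)
  set E₂ : ℝ := (n : ℝ) ^ (5 / 3 : ℝ) / (m : ℝ) ^ (5 / 3 : ℝ)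
  have hE₀ : 0 ≤ E₀ := by positivity
  have hE₁ : 0 ≤ E₁ := by positivity
  have hE₂ : 0 ≤ E₂ := by positivity
  have c₀' : (S₀.card : ℝ) ≤ 27 * T ^ 17 * E₀ := by
    calc (S₀.card : ℝ) ≤ 20 * E₀ * T ^ 6 := c₀
      _ ≤ 27 * E₀ * T ^ 17 := by
          gcongr
          · norm_num
          · norm_num
      _ = _ := by ring
  have c₁' : (S₁.card : ℝ) ≤ 27 * T ^ 17 * min E₁ E₂ := by
    rw [mul_min_of_nonneg _ _ (by positivity)]
    refine le_min ?_ ?_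
    · calc (S₁.card : ℝ) ≤ 18 * E₁ * T ^ 17 := c₁
        _ ≤ 27 * E₁ * T ^ 17 := by
            gcongr
            norm_num
        _ = _ := by ring
    · calc (S₁.card : ℝ) ≤ 27 * E₂ * T ^ 7 := c₂
        _ ≤ 27 * E₂ * T ^ 17 := by
            gcongr
            norm_num
        _ = _ := by ring
  have hmin := add_min_le_min hx hy hxy
  have hmin0 : 0 ≤ E₀ + min E₁ E₂ := by positivity
  calc ((hfin.toFinset.card : ℕ) : ℝ) = S₀.card + S₁.card := by rw [hcard]; push_cast; rfl
    _ ≤ 27 * T ^ 17 * (E₀ + min E₁ E₂) := by linarith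
    _ ≤ 27 * (C * (n : ℝ) ^ ε) * (E₀ + min E₁ E₂) := by
        gcongr
        exact hT n hn
    _ ≤ 27 * (C * (n : ℝ) ^ ε) * (8 * _) := by gcongr
    _ = _ := by ring
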